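/- Let $d\ge 1$ and $\alpha\in(0,1)$. Let $\tilde\mu$ be a finite symmetric Borel measure on the unit sphere $\mathbb S^{d-1}\subset\mathbb R^d$, and let $\nu_\alpha$ be the Lévy measure given in polar coordinates $y=\rho s$ by $\nu_\alpha(dy)=\rho^{-1-\alpha}\,d\rho\,\tilde\mu(ds)$, with symbol $\Psi(\lambda)=\int_{\mathbb R^d}(e^{i\langle\lambda,y\rangle}-1)\,\nu_\alpha(dy)$ and operator $L_\alpha\phi(x)=\int_{\mathbb R^d}(\phi(x+y)-\phi(x))\,\nu_\alpha(dy)$. The associated spectral measure is $\mu=C_\alpha\tilde\mu$ with $C_\alpha=\int_0^\infty(1-\cos r)\,r^{-1-\alpha}\,dr$. For $\eta\ge 1$, say that $\mu$ is non-degenerate with constant $\eta$ if $$\eta^{-1}|\lambda|^\alpha\le\int_{\mathbb S^{d-1}}|\langle\lambda,s\rangle|^\alpha\,\mu(ds)\le\eta|\lambda|^\alpha\qquad\text{for all }\lambda\in\mathbb R^d .$$ Put, for $t>0$ and $y\in\mathbb R^d$, $$p_\alpha(t,y)=\frac1{(2\pi)^d}\int_{\mathbb R^d}e^{-i\langle y,\lambda\rangle}\exp\Big(-t\int_{\mathbb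 S^{d-1}}|\langle\lambda,s\rangle|^\alpha\,\mu(ds)\Big)\,d\lambda .$$ (1) For all $\eta\ge1$ and $0\le\gamma<\alpha$ there is a constant $C>0$, depending only on $d,\alpha,\eta,\gamma$, such that for every such $\tilde\mu$ whose spectral measure $\mu$ is non-degenerate with constant $\eta$, all $\ell\in\{1,2\}$ and all $t>0$, $$\int_{\mathbb R^d}|y|^\gamma\,|D^\ell_y p_\alpha(t,y)|\,dy\le\frac{C}{t^{(\ell-\gamma)/\alpha}} ,$$ the integral being finite. (2) Let $\mu$ be non-degenerate with some constant $\eta\ge1$. Then $\nu_\alpha(\{0\})=0$ and $\int(1\wedge|y|)\,\nu_\alpha(dy)<\infty$; for every $t>0$, $p_\alpha(t,\cdot)$ is a $C^\infty$ probability density with characteristic function $e^{t\Psi}$, i.e. it is the density at time $t$ of the convolution semigroup with generator $L_\alpha$; and for each $\gamma\in(0,\alpha)$ there is $c>0$ with $\int|y|^\gamma p_\alpha(t,y)\,dy\le c\,t^{\gamma/\alpha}$ for $t\in(0,1]$. Moreover, for every $\beta\in(0,\alpha)$, property $(\mathscr P_\beta)$ holds: there is $c>0$ with $$\int_{\mathbb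 R^d}|y|^\beta\,|D^k_yp_\alpha(t,y)|\,dy\le\frac{c}{t^{(k-\beta)/\alpha}},\qquad t\in(0,1],\ k=1,2 .$$ In particular, if $\alpha\in(1/2,1)$, there is $\beta\in(0,1)$ with $\alpha+\beta>1$ for which $(\mathscr P_\beta)$ holds. (3) The cylindrical operator $\sum_{k=1}^d(\partial^2_{x_kx_k})^{\alpha/2}$ is covered: for $\tilde\mu=\frac1{2C_\alpha}\sum_{k=1}^d(\delta_{e_k}+\delta_{-e_k})$, where $e_1,\dots,e_d$ is the canonical basis, $\tilde\mu$ is finite and symmetric, $\Psi(\lambda)=-\sum_{k=1}^d|\lambda_k|^\alpha$, and $\mu$ is non-degenerate with some constant $\eta\ge1$. -/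

import Mathlib

open MeasureTheory Set
open scoped ContDiff

noncomputable section

namespace StableKernel

/-- The unit sphere of `ℝ^d` (with the Euclidean norm). -/
abbrev UnitSphere (d : ℕ) : Type :=
  Metric.sphere (0 : EuclideanSpace ℝ (Fin d)) 1

/-- A measure on the unit sphere is symmetric if it is invariant under `s ↦ -s`. -/
def IsSymmetric {d : ℕ} (m : Measure (UnitSphere d)) : Prop :=
  m.map (fun s => -s) = m

/-- The Lévy measure `ν(dy) = dρ m(ds) / ρ^(1+α)` in polar coordinates `y = ρ s`,
with spherical part `m`. -/
def stableLevyMeasure {d : ℕ} (α : ℝ) (m : Measure (UnitSphere d)) :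
    Measure (EuclideanSpace ℝ (Fin d)) :=
  Measure.map (fun q : ℝ × UnitSphere d => q.1 • (q.2 : EuclideanSpace ℝ (Fin d)))
    (((volume.restrict (Ioi (0 : ℝ))).withDensity
      (fun ρ => ENNReal.ofReal (ρ ^ (-(1 + α))))).prod m)

/-- A Lévy measure for which `L φ (x) = ∫ (φ (x + y) - φ x) ν(dy)` makes sense without
compensator: no mass at the origin and `∫ (1 ∧ |y|) ν(dy) < ∞`. -/
def IsFiniteVariationLevyMeasure {d : ℕ} (ν : Measure (EuclideanSpace ℝ (Fin d))) : Prop :=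
  ν {0} = 0 ∧ ∫⁻ y, ENNReal.ofReal (min 1 ‖y‖) ∂ν < ⊤

/-- The Lévy symbol `Ψ(ξ) = ∫ (e^{i⟨ξ,y⟩} - 1) ν(dy)`. -/
def levySymbol {d : ℕ} (ν : Measure (EuclideanSpace ℝ (Fin d)))
    (ξ : EuclideanSpace ℝ (Fin d)) : ℂ :=
  ∫ y, (Complex.exp (Complex.I * ((inner ℝ ξ y : ℝ) : ℂ)) - 1) ∂ν

/-- The positive constant relating the spherical part of the Lévy measure to the spectral
measure. -/
def spectralConst (α : ℝ) : ℝ :=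
  ∫ r in Ioi (0 : ℝ), (1 - Real.cos r) * r ^ (-(1 + α))

/-- The spectral measure of the stable operator whose Lévy measure has spherical part `m`. -/
def spectralMeasure {d : ℕ} (α : ℝ) (m : Measure (UnitSphere d)) : Measure (UnitSphere d) :=
  ENNReal.ofReal (spectralConst α) • m

/-- `∫ |⟨ξ,s⟩|^α μ(ds)`, an integral over the unit sphere. -/
def spectralIntegral {d : ℕ} (α : ℝ) (μ : Measure (UnitSphere d))
    (ξ : EuclideanSpace ℝ (Fin d)) : ℝ :=
  ∫ s : UnitSphere d, |(inner ℝ ξ (s : EuclideanSpace ℝ (Fin d)) : ℝ)| ^ α ∂μ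

/-- Non-degeneracy of the spectral measure, with constant `η`. -/
def NonDegenerate {d : ℕ} (α η : ℝ) (μ : Measure (UnitSphere d)) : Prop :=
  ∀ ξ : EuclideanSpace ℝ (Fin d),
    η⁻¹ * ‖ξ‖ ^ α ≤ spectralIntegral α μ ξ ∧ spectralIntegral α μ ξ ≤ η * ‖ξ‖ ^ α

/-- The heat kernel `p_α(t, y)`, by Fourier inversion, in terms of the spectral measure `μ`
(the complex integral is real for a symmetric `μ`). -/
def heatKernel {d : ℕ} (α : ℝ) (μ : Measure (UnitSphere d)) (t : ℝ)
    (y : EuclideanSpace ℝ (Fin d)) : ℝ :=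
  ((2 * Real.pi) ^ d)⁻¹ *
    (∫ ξ : EuclideanSpace ℝ (Fin d),
      Complex.exp (-(Complex.I * ((inner ℝ y ξ : ℝ) : ℂ))) *
        ((Real.exp (-(t * spectralIntegral α μ ξ)) : ℝ) : ℂ)).re

/-- For every `t > 0`, `p t` is a probability density, and the law it defines is the law at
time `t` of the pure jump Lévy process with Lévy measure `ν`, that is, the member `μ_t` of
the convolution semigroup with characteristic functions `exp (t Ψ)`. -/
def IsSemigroupDensity {d : ℕ} (ν : Measure (EuclideanSpace ℝ (Fin d)))
    (p : ℝ → EuclideanSpace ℝ (Fin d) → ℝ) : Prop :=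
  ∀ t : ℝ, 0 < t →
    (∀ y, 0 ≤ p t y) ∧
    IsProbabilityMeasure (volume.withDensity (fun y => ENNReal.ofReal (p t y))) ∧
    ∀ ξ : EuclideanSpace ℝ (Fin d),
      charFun (volume.withDensity (fun y => ENNReal.ofReal (p t y))) ξ =
        Complex.exp ((t : ℂ) * levySymbol ν ξ)

/-- `∫ |y|^γ |D^ℓ f (y)| dy` is finite and at most `B`. -/
def WeightedDerivBound {d : ℕ} (γ : ℝ) (l : ℕ) (f : EuclideanSpace ℝ (Fin d) → ℝ)
    (B : ℝ) : Prop :=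
  Integrable (fun y => ‖y‖ ^ γ * ‖iteratedFDeriv ℝ l f y‖) ∧
    ∫ y, ‖y‖ ^ γ * ‖iteratedFDeriv ℝ l f y‖ ≤ B

/-- The semigroup with Lévy measure `ν` has the `C²` density `p t`, `t > 0`, and the moments
of order `γ ∈ (0, α)` are bounded by `c(γ, α) t^(γ/α)`, `t ∈ (0, 1]`. -/
def MomentAssumption {d : ℕ} (α : ℝ) (ν : Measure (EuclideanSpace ℝ (Fin d)))
    (p : ℝ → EuclideanSpace ℝ (Fin d) → ℝ) : Prop :=
  IsSemigroupDensity ν p ∧ (∀ t : ℝ, 0 < t → ContDiff ℝ 2 (p t)) ∧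
    ∀ γ : ℝ, 0 < γ → γ < α → ∃ c : ℝ, 0 < c ∧ ∀ t ∈ Ioc (0 : ℝ) 1,
      Integrable (fun y => ‖y‖ ^ γ * p t y) ∧ ∫ y, ‖y‖ ^ γ * p t y ≤ c * t ^ (γ / α)

/-- The smoothing property `(𝒫_β)`. -/
def PropertyP {d : ℕ} (α β : ℝ) (p : ℝ → EuclideanSpace ℝ (Fin d) → ℝ) : Prop :=
  ∃ c : ℝ, 0 < c ∧ ∀ t ∈ Ioc (0 : ℝ) 1, ∀ k ∈ ({1, 2} : Set ℕ),
    WeightedDerivBound β k (p t) (c / t ^ (((k : ℝ) - β) / α))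

/-- The `k`-th canonical basis vector as a point of the unit sphere. -/
def canonicalDirection {d : ℕ} (k : Fin d) : UnitSphere d :=
  ⟨EuclideanSpace.single k (1 : ℝ), by simp⟩

/-- The spherical part of the Lévy measure of the cylindrical operator
`∑ k, (∂²/∂x_k²)^(α/2)`, a sum of Dirac masses along the canonical directions. -/
def cylindricalSphericalMeasure (d : ℕ) (α : ℝ) : Measure (UnitSphere d) :=
  ENNReal.ofReal ((2 * spectralConst α)⁻¹) •
    ∑ k : Fin d, (Measure.dirac (canonicalDirection k) + Measure.dirac (-canonicalDirection k))

end StableKernel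

end

/-! The Lévy measure is cut at the unit ball. The large jumps have finite mass, so their exponential
is the characteristic function of a compound Poisson law `P`. The small jumps have a finite first
moment and bounded support, so their exponent `levyExponent` is smooth, with all derivatives of
order at least one bounded by that moment. Hence `exp Ψ = charFun P * g`, where `g` is smooth. Since
the large jumps lower the real part of the exponent by a bounded amount only, `g` and its
derivatives inherit the decay `exp (-c ‖ξ‖^α)` given by non-degeneracy.

On the Fourier side, `𝓕 (exp Ψ)` is then `𝓕 g` convolved with a rescaled copy of `P`. Derivatives
fall on `𝓕 g`, which decays as fast as any fixed power, and the weight `‖y‖^γ` is shared between `𝓕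
g` and `P`; the latter has moments of order `γ < α` because the large jumps do. This is
`exists_weighted_bound_levy`. Its constants depend on the spherical measure only through its mass,
which `measureReal_univ_le_of_nonDegenerate` controls by `η`.

Self-similarity (`heatKernel_eq`) reduces every time `t` to one kernel, `unitKernel`, and produces
the powers of `t`. Positivity comes from approximating `exp Ψ` by compound Poisson characteristic
functions (`fourier_exp_levyExponent_re_nonneg`), and Fourier inversion identifies the
characteristic function. -/

noncomputable section

namespace StableKernel

set_option linter.unusedSectionVars false

/-! ### Compound Poisson laws: characteristic function and fractional moments. -/

section CompoundPoisson

variable {E : Type*} [NormedAddCommGroup E] [InnerProductSpace ℝ E] [MeasurableSpace E]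
  [BorelSpace E] [SecondCountableTopology E]

/-- The `n`-fold convolution power of a measure. -/
def convPow (ν : Measure E) : ℕ → Measure E
  | 0 => Measure.dirac 0
  | n + 1 => (convPow ν n).conv ν

instance isFiniteMeasure_convPow (ν : Measure E) [IsFiniteMeasure ν] :
    ∀ n, IsFiniteMeasure (convPow ν n)
  | 0 => by unfold convPow; infer_instance
  | n + 1 => by
    have := isFiniteMeasure_convPow ν n
    unfold convPow; infer_instance

lemma charFun_convPow (ν : Measure E) [IsFiniteMeasure ν] (n : ℕ) (ξ : E) :
    charFun (convPow ν n) ξ = charFun ν ξ ^ n := by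
  induction n with
  | zero => simp [convPow, charFun_dirac]
  | succ n ih => rw [convPow, charFun_conv, ih, pow_succ]

lemma convPow_univ (ν : Measure E) [IsFiniteMeasure ν] (n : ℕ) :
    convPow ν n univ = ν univ ^ n := by
  induction n with
  | zero => simp [convPow]
  | succ n ih =>
    rw [convPow, Measure.conv, Measure.map_apply (by fun_prop) MeasurableSet.univ, preimage_univ,
      ← univ_prod_univ, Measure.prod_prod, ih, pow_succ]

lemma norm_add_rpow_le {γ : ℝ} (h0 : 0 ≤ γ) (h1 : γ ≤ 1) (x y : E) :
    ‖x + y‖ ^ γ ≤ ‖x‖ ^ γ + ‖y‖ ^ γ :=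
  (Real.rpow_le_rpow (norm_nonneg _) (norm_add_le x y) h0).trans
    (Real.rpow_add_le_add_rpow (norm_nonneg _) (norm_nonneg _) h0 h1)

/-- For `γ ≤ 1` the map `r ↦ r^γ` is subadditive, so each of the `n + 1` independent jumps
contributes one moment of `ν`, while the other `n` contribute their mass. -/
lemma lintegral_norm_rpow_convPow_succ_le {γ : ℝ} (h0 : 0 < γ) (h1 : γ ≤ 1) (ν : Measure E)
    [IsFiniteMeasure ν] (n : ℕ) :
    ∫⁻ y, ENNReal.ofReal (‖y‖ ^ γ) ∂(convPow ν (n + 1)) ≤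
      (n + 1) * ν univ ^ n * ∫⁻ y, ENNReal.ofReal (‖y‖ ^ γ) ∂ν := by
  have step : ∀ n, ∫⁻ y, ENNReal.ofReal (‖y‖ ^ γ) ∂(convPow ν (n + 1)) ≤
      (∫⁻ y, ENNReal.ofReal (‖y‖ ^ γ) ∂(convPow ν n)) * ν univ +
        ν univ ^ n * ∫⁻ y, ENNReal.ofReal (‖y‖ ^ γ) ∂ν := by
    intro n
    have hm : Measurable fun y : E => ENNReal.ofReal (‖y‖ ^ γ) := by fun_prop
    rw [convPow, Measure.lintegral_conv hm]
    calc ∫⁻ x, ∫⁻ y, ENNReal.ofReal (‖x + y‖ ^ γ) ∂ν ∂(convPow ν n)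
        ≤ ∫⁻ x, ∫⁻ y, (ENNReal.ofReal (‖x‖ ^ γ) + ENNReal.ofReal (‖y‖ ^ γ)) ∂ν ∂(convPow ν n) := by
          gcongr with x y
          rw [← ENNReal.ofReal_add (by positivity) (by positivity)]
          exact ENNReal.ofReal_le_ofReal (norm_add_rpow_le h0.le h1 x y)
      _ = _ := by
          simp_rw [lintegral_add_left measurable_const]
          rw [lintegral_add_right _ measurable_const]
          simp only [lintegral_const, convPow_univ]
          rw [lintegral_mul_const _ hm, mul_comm (ν univ ^ n)]
  induction n with
  | zero =>
    refine (step 0).trans ?_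
    simp only [convPow, lintegral_dirac, norm_zero]
    simp [Real.zero_rpow h0.ne']
  | succ n ih =>
    refine (step (n + 1)).trans ?_
    grw [ih]
    apply le_of_eq
    push_cast
    ring

/-- The compound Poisson law with finite Lévy measure `ν`. -/
def compoundPoisson (ν : Measure E) : Measure E :=
  Measure.sum fun n : ℕ =>
    ENNReal.ofReal (Real.exp (-ν.real univ) / n.factorial) • convPow ν n

lemma compoundPoisson_univ (ν : Measure E) [IsFiniteMeasure ν] :
    compoundPoisson ν univ = 1 := by
  rw [compoundPoisson, Measure.sum_apply _ MeasurableSet.univ]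
  have h : ∀ n : ℕ, (ENNReal.ofReal (Real.exp (-ν.real univ) / n.factorial) • convPow ν n) univ =
      ENNReal.ofReal (Real.exp (-ν.real univ) * (ν.real univ ^ n / n.factorial)) := by
    intro n
    rw [Measure.smul_apply, convPow_univ, smul_eq_mul, ← ofReal_measureReal (μ := ν),
      ← ENNReal.ofReal_pow measureReal_nonneg, ← ENNReal.ofReal_mul (by positivity)]
    congr 1
    ring
  simp_rw [h]
  have hs := NormedSpace.expSeries_div_hasSum_exp (𝔸 := ℝ) (ν.real univ)
  rw [← Real.exp_eq_exp_ℝ] at hs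
  have hs' := hs.mul_left (Real.exp (-ν.real univ))
  rw [← Real.exp_add, neg_add_cancel, Real.exp_zero] at hs'
  rw [← ENNReal.ofReal_tsum_of_nonneg (fun n => by positivity) hs'.summable, hs'.tsum_eq,
    ENNReal.ofReal_one]

instance isProbabilityMeasure_compoundPoisson (ν : Measure E) [IsFiniteMeasure ν] :
    IsProbabilityMeasure (compoundPoisson ν) := ⟨compoundPoisson_univ ν⟩

/-- The factor `n + 1` of the moment bound turns `1 / (n + 1)!` into `1 / n!`, so the shifted series
is the total mass of the law, namely `1`. Positivity of `γ` kills the term without jumps. -/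
lemma lintegral_norm_rpow_compoundPoisson_le {γ : ℝ} (h0 : 0 < γ) (h1 : γ ≤ 1) (ν : Measure E)
    [IsFiniteMeasure ν] :
    ∫⁻ y, ENNReal.ofReal (‖y‖ ^ γ) ∂(compoundPoisson ν) ≤
      ∫⁻ y, ENNReal.ofReal (‖y‖ ^ γ) ∂ν := by
  have hP := compoundPoisson_univ ν
  rw [compoundPoisson, Measure.sum_apply _ MeasurableSet.univ] at hP
  rw [compoundPoisson, lintegral_sum_measure, tsum_eq_zero_add' ENNReal.summable]
  have hz : ∫⁻ y, ENNReal.ofReal (‖y‖ ^ γ) ∂(ENNReal.ofReal (Real.exp (-ν.real univ) /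
      (Nat.factorial 0)) • convPow ν 0) = 0 := by
    simp [convPow, Real.zero_rpow h0.ne']
  rw [hz, zero_add]
  calc ∑' n : ℕ, ∫⁻ y, ENNReal.ofReal (‖y‖ ^ γ) ∂(ENNReal.ofReal (Real.exp (-ν.real univ) /
      (Nat.factorial (n + 1))) • convPow ν (n + 1))
      ≤ ∑' n : ℕ, (ENNReal.ofReal (Real.exp (-ν.real univ) / n.factorial) • convPow ν n) univ *
          ∫⁻ y, ENNReal.ofReal (‖y‖ ^ γ) ∂ν := by
        gcongr with n
        rw [lintegral_smul_measure, Measure.smul_apply, convPow_univ, smul_eq_mul, smul_eq_mul]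
        grw [lintegral_norm_rpow_convPow_succ_le h0 h1]
        rw [← mul_assoc, ← mul_assoc]
        have : ENNReal.ofReal (Real.exp (-ν.real univ) / (Nat.factorial (n + 1))) * ((n : ENNReal) + 1)
            = ENNReal.ofReal (Real.exp (-ν.real univ) / n.factorial) := by
          have h : ((n : ENNReal) + 1) = ENNReal.ofReal ((n : ℝ) + 1) := by
            rw [ENNReal.ofReal_add (by positivity) zero_le_one]; simp
          rw [h, ← ENNReal.ofReal_mul (by positivity), Nat.factorial_succ]
          congr 1
          push_cast
          field_simp
        rw [this]
    _ = ∫⁻ y, ENNReal.ofReal (‖y‖ ^ γ) ∂ν := by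
        rw [ENNReal.tsum_mul_right, hP, one_mul]

lemma integrable_exp_inner_mul_I (μ : Measure E) [IsFiniteMeasure μ] (ξ : E) :
    Integrable (fun y => Complex.exp ((inner ℝ y ξ : ℝ) * Complex.I)) μ := by
  refine Integrable.of_bound (C := 1) (by fun_prop) ?_
  filter_upwards with y
  rw [Complex.norm_exp_ofReal_mul_I]

lemma charFun_compoundPoisson (ν : Measure E) [IsFiniteMeasure ν] (ξ : E) :
    charFun (compoundPoisson ν) ξ =
      Complex.exp (∫ y, (Complex.exp ((inner ℝ y ξ : ℝ) * Complex.I) - 1) ∂ν) := by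
  have hi := integrable_exp_inner_mul_I (compoundPoisson ν) ξ
  rw [integral_sub (integrable_exp_inner_mul_I ν ξ) (integrable_const _), ← charFun_apply,
    charFun_apply, compoundPoisson, integral_sum_measure hi]
  have h : ∀ n : ℕ, ∫ y, Complex.exp ((inner ℝ y ξ : ℝ) * Complex.I)
      ∂(ENNReal.ofReal (Real.exp (-ν.real univ) / n.factorial) • convPow ν n) =
      Complex.exp (-(ν.real univ : ℂ)) * (charFun ν ξ ^ n / n.factorial) := by
    intro n
    rw [integral_smul_measure, ← charFun_apply, charFun_convPow,
      ENNReal.toReal_ofReal (by positivity), Complex.real_smul]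
    push_cast
    ring
  simp_rw [h]
  have hs := (NormedSpace.expSeries_div_hasSum_exp (𝔸 := ℂ) (charFun ν ξ)).mul_left
    (Complex.exp (-(ν.real univ : ℂ)))
  rw [← Complex.exp_eq_exp_ℂ] at hs
  rw [hs.tsum_eq, ← Complex.exp_add]
  congr 1
  simp
  ring

/-- The summand `1` takes care of `γ = 0`, where the weight is identically one, also at the origin.
-/
lemma lintegral_norm_rpow_compoundPoisson_le_one_add {γ : ℝ} (h0 : 0 ≤ γ) (h1 : γ ≤ 1)
    (ν : Measure E) [IsFiniteMeasure ν] :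
    ∫⁻ y, ENNReal.ofReal (‖y‖ ^ γ) ∂(compoundPoisson ν) ≤
      1 + ∫⁻ y, ENNReal.ofReal (‖y‖ ^ γ) ∂ν := by
  rcases h0.eq_or_lt with rfl | h
  · simp
  · exact (lintegral_norm_rpow_compoundPoisson_le h h1 ν).trans le_add_self

end CompoundPoisson

/-! ### Smoothness of the exponent of the small jumps. -/

section LevyExponent

open VectorFourier FourierTransform

variable {V : Type*} [NormedAddCommGroup V] [InnerProductSpace ℝ V] [MeasurableSpace V]
  [BorelSpace V] [SecondCountableTopology V]

/-- The exponent `∫ (e^{i⟨ξ,y⟩} - 1) κ(dy)` of a measure on an inner product space. -/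
def levyExponent (κ : Measure V) (ξ : V) : ℂ :=
  ∫ y, (Complex.exp (Complex.I * ((inner ℝ ξ y : ℝ) : ℂ)) - 1) ∂κ

lemma charFun_compoundPoisson' (ν : Measure V) [IsFiniteMeasure ν] (ξ : V) :
    charFun (compoundPoisson ν) ξ = Complex.exp (levyExponent ν ξ) := by
  rw [charFun_compoundPoisson, levyExponent]
  simp_rw [mul_comm Complex.I, real_inner_comm ξ]

lemma norm_exp_I_mul_inner_sub_one_le (ξ y : V) :
    ‖Complex.exp (Complex.I * ((inner ℝ ξ y : ℝ) : ℂ)) - 1‖ ≤ ‖ξ‖ * ‖y‖ :=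
  (Real.norm_exp_I_mul_ofReal_sub_one_le).trans (norm_inner_le_norm ξ y)

lemma norm_exp_I_mul_inner_sub_one_le_two (ξ y : V) :
    ‖Complex.exp (Complex.I * ((inner ℝ ξ y : ℝ) : ℂ)) - 1‖ ≤ 2 := by
  refine (norm_sub_le _ _).trans ?_
  rw [Complex.norm_exp_I_mul_ofReal]
  norm_num

/-- The integrand of the derivative of `levyExponent`. -/
def levyDerivIntegrand (y : V) : V →L[ℝ] ℂ :=
  Complex.I • (Complex.ofRealCLM ∘L innerSL ℝ y)

lemma continuous_levyDerivIntegrand : Continuous (levyDerivIntegrand : V → V →L[ℝ] ℂ) := by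
  have h : Continuous fun y : V => (innerSL ℝ y : V →L[ℝ] ℝ) := (innerSL ℝ).continuous
  have h' := (ContinuousLinearMap.compL ℝ V ℝ ℂ Complex.ofRealCLM).continuous.comp h
  exact h'.const_smul Complex.I

lemma norm_levyDerivIntegrand_le (y : V) : ‖levyDerivIntegrand y‖ ≤ ‖y‖ := by
  refine ContinuousLinearMap.opNorm_le_bound _ (norm_nonneg _) fun x => ?_
  simp only [levyDerivIntegrand, smul_apply, ContinuousLinearMap.comp_apply,
    Complex.ofRealCLM_apply, innerSL_apply_apply, norm_smul, Complex.norm_I, one_mul,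
    Complex.norm_real]
  exact norm_inner_le_norm y x

/-- The pairing for which `VectorFourier.fourierIntegral` has the kernel `e^{i⟨ξ,y⟩}`. -/
def negTwoPiInner (V : Type*) [NormedAddCommGroup V] [InnerProductSpace ℝ V] :
    V →L[ℝ] V →L[ℝ] ℝ := (-(2 * Real.pi)⁻¹) • innerSL ℝ

lemma negTwoPiInner_apply (x y : V) :
    negTwoPiInner V x y = -(2 * Real.pi)⁻¹ * inner ℝ x y := rfl

lemma two_pi_mul_norm_negTwoPiInner_le : 2 * Real.pi * ‖negTwoPiInner V‖ ≤ 1 := by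
  have h : ‖negTwoPiInner V‖ ≤ (2 * Real.pi)⁻¹ := by
    refine ContinuousLinearMap.opNorm_le_bound₂ _ (by positivity) fun x y => ?_
    rw [negTwoPiInner_apply, norm_mul, norm_neg, Real.norm_of_nonneg (by positivity), mul_assoc]
    gcongr
    exact norm_inner_le_norm x y
  calc 2 * Real.pi * ‖negTwoPiInner V‖ ≤ 2 * Real.pi * (2 * Real.pi)⁻¹ := by gcongr
    _ = 1 := mul_inv_cancel₀ (by positivity)

/-- Differentiation under the integral, dominated by `‖y‖`. Writing the derivative as a
`fourierIntegral` makes the general results on smoothness and iterated derivatives of Fourier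
integrals available for all higher orders. -/
lemma hasFDerivAt_levyExponent {κ : Measure V} (hκ : Integrable (fun y => ‖y‖) κ) (ξ : V) :
    HasFDerivAt (levyExponent κ)
      (fourierIntegral 𝐞 κ (negTwoPiInner V).toLinearMap₁₂ levyDerivIntegrand ξ) ξ := by
  have key : ∀ y ξ : V, HasFDerivAt
      (fun ξ => Complex.exp (Complex.I * ((inner ℝ ξ y : ℝ) : ℂ)) - 1)
      (Complex.exp (Complex.I * ((inner ℝ ξ y : ℝ) : ℂ)) • levyDerivIntegrand y) ξ := by
    intro y ξ
    have h1 : HasFDerivAt (fun ξ : V => ((inner ℝ ξ y : ℝ) : ℂ))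
        (Complex.ofRealCLM ∘L innerSL ℝ y) ξ := by
      have := (Complex.ofRealCLM ∘L innerSL ℝ y).hasFDerivAt (x := ξ)
      refine this.congr_of_eventuallyEq (Filter.Eventually.of_forall fun x => ?_)
      simp [real_inner_comm]
    exact ((h1.const_mul Complex.I).cexp).sub_const 1
  have hF : ∀ ξ : V, fourierIntegral 𝐞 κ (negTwoPiInner V).toLinearMap₁₂ levyDerivIntegrand ξ =
      ∫ y, Complex.exp (Complex.I * ((inner ℝ ξ y : ℝ) : ℂ)) • levyDerivIntegrand y ∂κ := by
    intro ξ
    unfold fourierIntegral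
    congr 1
    ext1 y
    rw [Circle.smul_def, Real.fourierChar_apply]
    congr 2
    change ((2 * Real.pi * -(negTwoPiInner V y ξ) : ℝ) : ℂ) * Complex.I = _
    rw [negTwoPiInner_apply, neg_mul, neg_neg, real_inner_comm, mul_comm Complex.I, ← mul_assoc,
      mul_inv_cancel₀ (by positivity), one_mul]
  rw [hF]
  unfold levyExponent
  refine hasFDerivAt_integral_of_dominated_of_fderiv_le (s := univ) (bound := fun y => ‖y‖)
    (F' := fun ξ y => Complex.exp (Complex.I * ((inner ℝ ξ y : ℝ) : ℂ)) • levyDerivIntegrand y)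
    Filter.univ_mem (Filter.Eventually.of_forall fun x => ?_) ?_ ?_ ?_ hκ ?_
  · exact Continuous.aestronglyMeasurable (by fun_prop)
  · refine (hκ.const_mul ‖ξ‖).mono' (Continuous.aestronglyMeasurable (by fun_prop)) ?_
    filter_upwards with y using norm_exp_I_mul_inner_sub_one_le ξ y
  · have := continuous_levyDerivIntegrand (V := V)
    exact Continuous.aestronglyMeasurable (by fun_prop)
  · filter_upwards with y x _
    rw [norm_smul, Complex.norm_exp_I_mul_ofReal, one_mul]
    exact norm_levyDerivIntegrand_le y
  · filter_upwards with y x _ using key y x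

lemma integrable_pow_mul_levyDerivIntegrand {κ : Measure V} (hκ : Integrable (fun y => ‖y‖) κ)
    (hb : ∀ᵐ y ∂κ, ‖y‖ ≤ 1) (n : ℕ) :
    Integrable (fun y => ‖y‖ ^ n * ‖levyDerivIntegrand y‖) κ := by
  refine hκ.mono' (Continuous.aestronglyMeasurable ?_) ?_
  · have := continuous_levyDerivIntegrand (V := V)
    fun_prop
  · filter_upwards [hb] with y hy
    rw [Real.norm_of_nonneg (by positivity)]
    exact (mul_le_of_le_one_left (norm_nonneg _) (pow_le_one₀ (norm_nonneg _) hy)).trans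
      (norm_levyDerivIntegrand_le y)

lemma contDiff_levyExponent {κ : Measure V} (hκ : Integrable (fun y => ‖y‖) κ)
    (hb : ∀ᵐ y ∂κ, ‖y‖ ≤ 1) : ContDiff ℝ ∞ (levyExponent κ) := by
  rw [contDiff_infty_iff_fderiv]
  refine ⟨fun ξ => (hasFDerivAt_levyExponent hκ ξ).differentiableAt, ?_⟩
  rw [show fderiv ℝ (levyExponent κ) = _ from
    funext fun ξ => (hasFDerivAt_levyExponent hκ ξ).fderiv]
  exact contDiff_fourierIntegral (N := ⊤) _ fun n _ => integrable_pow_mul_levyDerivIntegrand hκ hb n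

/-- The first derivative brings down one factor `‖y‖`; each further one brings down a factor at most
`‖y‖ ≤ 1`. One first moment therefore bounds all orders. -/
lemma norm_iteratedFDeriv_levyExponent_le {κ : Measure V} (hκ : Integrable (fun y => ‖y‖) κ)
    (hb : ∀ᵐ y ∂κ, ‖y‖ ≤ 1) {n : ℕ} (hn : 1 ≤ n) (ξ : V) :
    ‖iteratedFDeriv ℝ n (levyExponent κ) ξ‖ ≤ ∫ y, ‖y‖ ∂κ := by
  obtain ⟨k, rfl⟩ := Nat.exists_eq_add_of_le' hn
  rw [← norm_iteratedFDeriv_fderiv, show fderiv ℝ (levyExponent κ) = _ from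
    funext fun ξ => (hasFDerivAt_levyExponent hκ ξ).fderiv]
  rw [iteratedFDeriv_fourierIntegral (N := ⊤) _
    (fun n _ => integrable_pow_mul_levyDerivIntegrand hκ hb n)
    continuous_levyDerivIntegrand.aestronglyMeasurable (by exact_mod_cast le_top)]
  refine (norm_fourierIntegral_le_integral_norm _ _ _ _ _).trans ?_
  refine integral_mono_of_nonneg (Filter.Eventually.of_forall fun y => norm_nonneg _) hκ ?_
  filter_upwards [hb] with y hy
  refine (norm_fourierPowSMulRight_le _ _ _ _).trans ?_
  calc (2 * Real.pi * ‖negTwoPiInner V‖) ^ k * ‖y‖ ^ k * ‖levyDerivIntegrand y‖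
      ≤ 1 * 1 * ‖y‖ := by
        gcongr
        · exact pow_le_one₀ (by positivity) two_pi_mul_norm_negTwoPiInner_le
        · exact pow_le_one₀ (norm_nonneg _) hy
        · exact norm_levyDerivIntegrand_le y
    _ = ‖y‖ := by ring

lemma norm_iteratedFDeriv_cexp_le (n : ℕ) (z : ℂ) :
    ‖iteratedFDeriv ℝ n Complex.exp z‖ ≤ Real.exp z.re := by
  induction n with
  | zero => simp [Complex.norm_exp]
  | succ n ih =>
    let T : ℂ →L[ℝ] (ℂ →L[ℝ] ℂ) := ContinuousLinearMap.mul ℝ ℂ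
    have hT : fderiv ℝ Complex.exp = T ∘ Complex.exp := by
      ext1 w
      refine ((Complex.hasDerivAt_exp w).hasFDerivAt.restrictScalars ℝ).fderiv.trans ?_
      ext1 x
      simp [T, mul_comm]
    rw [← norm_iteratedFDeriv_fderiv, hT]
    refine (T.norm_iteratedFDeriv_comp_left (N := ∞) (Complex.contDiff_exp.contDiffAt)
      (by exact_mod_cast le_top)).trans ?_
    have h1 : ‖T‖ ≤ 1 := ContinuousLinearMap.opNorm_mul_le ℝ ℂ
    exact (mul_le_of_le_one_left (norm_nonneg _) h1).trans ih

/-- Faà di Bruno's bound for a composition. It asks for `M ^ i` on the `i`-th inner derivative,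
which is why `1 ≤ M` is required. -/
lemma norm_iteratedFDeriv_cexp_levyExponent_le {κ : Measure V}
    (hκ : Integrable (fun y => ‖y‖) κ) (hb : ∀ᵐ y ∂κ, ‖y‖ ≤ 1) {M : ℝ} (hM : 1 ≤ M)
    (hκM : ∫ y, ‖y‖ ∂κ ≤ M) (n : ℕ) (ξ : V) :
    ‖iteratedFDeriv ℝ n (fun ξ => Complex.exp (levyExponent κ ξ)) ξ‖ ≤
      n.factorial * Real.exp (levyExponent κ ξ).re * M ^ n := by
  refine norm_iteratedFDeriv_comp_le (N := ∞) (g := Complex.exp) Complex.contDiff_exp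
    (contDiff_levyExponent hκ hb) (by exact_mod_cast le_top) ξ
    (fun i _ => norm_iteratedFDeriv_cexp_le i _) fun i hi _ => ?_
  exact (norm_iteratedFDeriv_levyExponent_le hκ hb hi ξ).trans
    (hκM.trans (le_self_pow₀ hM (by omega)))

end LevyExponent

/-! ### Fourier transform of a product with a characteristic function; positivity. -/

section FourierConvolution

open VectorFourier FourierTransform

variable {V : Type*} [NormedAddCommGroup V] [InnerProductSpace ℝ V] [FiniteDimensional ℝ V]
  [MeasurableSpace V] [BorelSpace V]
  {F : Type*} [NormedAddCommGroup F] [NormedSpace ℂ F] [CompleteSpace F]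

/-- Fubini. The factor `(2π)⁻¹` reconciles the kernel `e^{i⟨w,v⟩}` of `charFun` with the kernel
`e^{-2πi⟨v,y⟩}` of `𝓕`. -/
lemma fourier_charFun_smul (P : Measure V) [IsFiniteMeasure P] {G : V → F} (hG : Integrable G)
    (y : V) :
    𝓕 (fun v => charFun P v • G v) y = ∫ w, 𝓕 G (y - (2 * Real.pi)⁻¹ • w) ∂P := by
  have hc : ∀ v w : V, Complex.exp (((-2 * Real.pi * inner ℝ v y : ℝ) : ℂ) * Complex.I) •
      Complex.exp ((inner ℝ w v : ℝ) * Complex.I) • G v =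
      Complex.exp (((-2 * Real.pi * inner ℝ v (y - (2 * Real.pi)⁻¹ • w) : ℝ) : ℂ) * Complex.I) •
        G v := by
    intro v w
    rw [smul_smul, ← Complex.exp_add, inner_sub_right, inner_smul_right, real_inner_comm v w]
    congr 2
    have : (-2 * Real.pi * (inner ℝ v y - (2 * Real.pi)⁻¹ * inner ℝ v w) : ℝ) =
        -2 * Real.pi * inner ℝ v y + inner ℝ v w := by
      field_simp
      ring
    rw [this]
    push_cast
    ring
  simp_rw [Real.fourier_eq']
  calc ∫ v, Complex.exp (((-2 * Real.pi * inner ℝ v y : ℝ) : ℂ) * Complex.I) •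
        charFun P v • G v
      = ∫ v, ∫ w, Complex.exp (((-2 * Real.pi * inner ℝ v (y - (2 * Real.pi)⁻¹ • w) : ℝ) : ℂ) *
          Complex.I) • G v ∂P := by
        congr 1
        ext1 v
        rw [charFun_apply, ← integral_smul_const, ← integral_smul]
        simp_rw [hc]
    _ = _ := by
        refine integral_integral_swap ?_
        refine (hG.norm.comp_fst P).mono' ?_ ?_
        · exact (Continuous.aestronglyMeasurable (by fun_prop)).smul hG.1.comp_fst
        · filter_upwards with p
          simp only [Function.uncurry, norm_smul, Complex.norm_exp_ofReal_mul_I, one_mul, le_refl]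

lemma continuous_charFun_of_isFiniteMeasure (P : Measure V) [IsFiniteMeasure P] :
    Continuous (charFun P) := by
  refine continuous_of_dominated (bound := fun _ => 1) (fun v => ?_) (fun v => ?_)
    (integrable_const _) ?_
  · exact Continuous.aestronglyMeasurable (by fun_prop)
  · filter_upwards with w
    rw [Complex.norm_exp_ofReal_mul_I]
  · filter_upwards with w
    fun_prop

/-- All derivatives of the convolution are put on the factor coming from `g`, so no smoothness of
`P` is needed. -/
lemma iteratedFDeriv_fourier_charFun_mul (P : Measure V) [IsFiniteMeasure P] {g : V → ℂ}
    (hg : ∀ n : ℕ, Integrable (fun v => ‖v‖ ^ n * ‖g v‖)) (hgm : AEStronglyMeasurable g)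
    (n : ℕ) (y : V) :
    iteratedFDeriv ℝ n (𝓕 (fun v => charFun P v * g v)) y =
      ∫ w, iteratedFDeriv ℝ n (𝓕 g) (y - (2 * Real.pi)⁻¹ • w) ∂P := by
  have hPm : AEStronglyMeasurable (charFun P) :=
    (continuous_charFun_of_isFiniteMeasure P).aestronglyMeasurable
  have hg' : ∀ n : ℕ, Integrable (fun v => ‖v‖ ^ n * ‖charFun P v * g v‖) := by
    intro n
    refine ((hg n).const_mul (P.real univ)).mono' ?_ ?_
    · exact (Continuous.aestronglyMeasurable (by fun_prop)).mul (hPm.mul hgm).norm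
    · filter_upwards with v
      rw [Real.norm_of_nonneg (by positivity), norm_mul]
      calc ‖v‖ ^ n * (‖charFun P v‖ * ‖g v‖) ≤ ‖v‖ ^ n * (P.real univ * ‖g v‖) := by
            gcongr
            exact norm_charFun_le v
        _ = _ := by ring
  rw [Real.iteratedFDeriv_fourier (N := ⊤) (fun n _ => hg' n) (hPm.mul hgm)
      (by exact_mod_cast le_top),
    Real.iteratedFDeriv_fourier (N := ⊤) (fun n _ => hg n) hgm (by exact_mod_cast le_top),
    ← fourier_charFun_smul P (integrable_fourierPowSMulRight _ (hg n) hgm)]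
  refine congrArg (fun h : V → V [×n]→L[ℝ] ℂ => 𝓕 h y) ?_
  ext v m
  simp only [fourierPowSMulRight_apply, smul_apply, smul_eq_mul,
    Complex.real_smul]
  ring

/-- The transform of a Gaussian is a positive Gaussian, and here it is averaged against `P`. -/
lemma fourier_charFun_mul_gaussian_re_nonneg (P : Measure V) [IsFiniteMeasure P] {δ : ℝ}
    (hδ : 0 < δ) (y : V) :
    0 ≤ (𝓕 (fun v => charFun P v * Complex.exp (-(δ : ℂ) * (‖v‖ : ℂ) ^ 2)) y).re := by
  have hG : Integrable (fun v : V => Complex.exp (-(δ : ℂ) * (‖v‖ : ℂ) ^ 2)) := by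
    simpa using GaussianFourier.integrable_cexp_neg_mul_sq_norm_add (V := V) (b := (δ : ℂ))
      (by simpa using hδ) 0 0
  have h := fourier_charFun_smul P hG y
  simp only [smul_eq_mul] at h
  rw [h]
  have hr : ∀ w : V, 𝓕 (fun v : V => Complex.exp (-(δ : ℂ) * (‖v‖ : ℂ) ^ 2)) w =
      (((Real.pi / δ) ^ (Module.finrank ℝ V / 2 : ℝ) * Real.exp (-Real.pi ^ 2 * ‖w‖ ^ 2 / δ) : ℝ) :
        ℂ) := by
    intro w
    rw [fourier_gaussian_innerProductSpace (by simpa using hδ)]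
    rw [Complex.ofReal_mul, Complex.ofReal_cpow (by positivity)]
    push_cast
    rfl
  simp_rw [hr]
  rw [integral_complex_ofReal, Complex.ofReal_re]
  exact integral_nonneg fun w => by positivity

/-- The `charFun (P n)` need not be integrable, so a Gaussian factor is inserted. For fixed `δ` it
dominates the limit in `n`; afterwards `δ → 0`, dominated by `‖f‖`. -/
lemma fourier_re_nonneg_of_tendsto_charFun {P : ℕ → Measure V} [∀ n, IsProbabilityMeasure (P n)]
    {f : V → ℂ} (hf : Integrable f)
    (hP : ∀ v, Filter.Tendsto (fun n => charFun (P n) v) Filter.atTop (nhds (f v))) (y : V) :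
    0 ≤ (𝓕 f y).re := by
  have hgauss : ∀ δ : ℝ, 0 < δ →
      0 ≤ (𝓕 (fun v => f v * Complex.exp (-(δ : ℂ) * (‖v‖ : ℂ) ^ 2)) y).re := by
    intro δ hδ
    have hG : Integrable (fun v : V => Complex.exp (-(δ : ℂ) * (‖v‖ : ℂ) ^ 2)) := by
      simpa using GaussianFourier.integrable_cexp_neg_mul_sq_norm_add (V := V) (b := (δ : ℂ))
        (by simpa using hδ) 0 0
    have hlim : Filter.Tendsto
        (fun n => 𝓕 (fun v => charFun (P n) v * Complex.exp (-(δ : ℂ) * (‖v‖ : ℂ) ^ 2)) y)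
        Filter.atTop (nhds (𝓕 (fun v => f v * Complex.exp (-(δ : ℂ) * (‖v‖ : ℂ) ^ 2)) y)) := by
      simp_rw [Real.fourier_eq']
      refine tendsto_integral_of_dominated_convergence
        (fun v => ‖Complex.exp (-(δ : ℂ) * (‖v‖ : ℂ) ^ 2)‖) (fun n => ?_) hG.norm (fun n => ?_) ?_
      · have := continuous_charFun_of_isFiniteMeasure (P n)
        exact Continuous.aestronglyMeasurable (by fun_prop)
      · filter_upwards with v
        rw [norm_smul, Complex.norm_exp_ofReal_mul_I, one_mul, norm_mul]
        exact mul_le_of_le_one_left (norm_nonneg _) (norm_charFun_le_one v)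
      · filter_upwards with v
        exact ((hP v).mul_const _).const_smul _
    exact ge_of_tendsto' (Complex.continuous_re.continuousAt.tendsto.comp hlim)
      fun n => fourier_charFun_mul_gaussian_re_nonneg (P n) hδ y
  have hlim : Filter.Tendsto
      (fun n : ℕ => 𝓕 (fun v => f v * Complex.exp (-((1 / ((n : ℝ) + 1) : ℝ) : ℂ) *
        (‖v‖ : ℂ) ^ 2)) y) Filter.atTop (nhds (𝓕 f y)) := by
    simp_rw [Real.fourier_eq']
    refine tendsto_integral_of_dominated_convergence (fun v => ‖f v‖) (fun n => ?_) hf.norm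
      (fun n => ?_) ?_
    · have h1 : Continuous fun v : V =>
          Complex.exp (((-2 * Real.pi * inner ℝ v y : ℝ) : ℂ) * Complex.I) := by fun_prop
      have h2 : Continuous fun v : V =>
          Complex.exp (-((1 / ((n : ℝ) + 1) : ℝ) : ℂ) * (‖v‖ : ℂ) ^ 2) := by fun_prop
      exact h1.aestronglyMeasurable.smul (hf.1.mul h2.aestronglyMeasurable)
    · filter_upwards with v
      rw [norm_smul, Complex.norm_exp_ofReal_mul_I, one_mul, norm_mul]
      refine mul_le_of_le_one_right (norm_nonneg _) ?_
      rw [Complex.norm_exp, Real.exp_le_one_iff]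
      have : -((1 / ((n : ℝ) + 1) : ℝ) : ℂ) * (‖v‖ : ℂ) ^ 2 =
          ((-(1 / ((n : ℝ) + 1) * ‖v‖ ^ 2) : ℝ) : ℂ) := by push_cast; ring
      rw [this, Complex.ofReal_re, neg_nonpos]
      positivity
    · filter_upwards with v
      have h0 : Filter.Tendsto (fun n : ℕ => ((1 / ((n : ℝ) + 1) : ℝ) : ℂ)) Filter.atTop
          (nhds ((0 : ℝ) : ℂ)) :=
        (Complex.continuous_ofReal.tendsto 0).comp tendsto_one_div_add_atTop_nhds_zero_nat
      have h1 := ((Complex.continuous_exp.tendsto _).comp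
        ((h0.neg).mul_const ((‖v‖ : ℂ) ^ 2))).const_mul (f v)
      simp only [Complex.ofReal_zero, neg_zero, zero_mul, Complex.exp_zero, mul_one] at h1
      exact h1.const_smul _
  exact ge_of_tendsto' (Complex.continuous_re.continuousAt.tendsto.comp hlim)
    fun n => hgauss _ (by positivity)

end FourierConvolution

/-! ### Weighted integral bounds for products `charFun P * g`. -/

section WeightedBound

open VectorFourier FourierTransform

variable {V : Type*} [NormedAddCommGroup V] [InnerProductSpace ℝ V] [FiniteDimensional ℝ V]
  [MeasurableSpace V] [BorelSpace V]

lemma integrable_norm_pow_mul_exp_neg [Nontrivial V] {c α : ℝ} (hc : 0 < c) (hα : 0 < α) (k : ℕ) :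
    Integrable (fun v : V => ‖v‖ ^ k * Real.exp (-(c * ‖v‖ ^ α))) := by
  rw [integrable_fun_norm_addHaar volume (f := fun x => x ^ k * Real.exp (-(c * x ^ α)))]
  refine (integrableOn_rpow_mul_exp_neg_mul_rpow
    (s := ((Module.finrank ℝ V - 1 + k : ℕ) : ℝ)) ?_ hα hc).congr_fun ?_ measurableSet_Ioi
  · exact lt_of_lt_of_le (by norm_num) (Nat.cast_nonneg _)
  · intro x _
    simp only [smul_eq_mul, Real.rpow_natCast, pow_add, neg_mul]
    ring

/-- Powers of `‖w‖` on `𝓕 g` cost derivatives of `g`, and derivatives of `𝓕 g` cost powers of `‖v‖`;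
the stretched exponential makes all the resulting integrals finite. The constant is the same for all
`g`, which enters only through `B`. -/
lemma exists_fourier_decay [Nontrivial V] {c α : ℝ} (hc : 0 < c) (hα : 0 < α) (K N : ℕ) :
    ∃ C : ℝ, 0 < C ∧ ∀ (g : V → ℂ) (B : ℝ), ContDiff ℝ ∞ g →
      (∀ n ≤ N, ∀ v, ‖iteratedFDeriv ℝ n g v‖ ≤ B * Real.exp (-(c * ‖v‖ ^ α))) →
      ∀ k ≤ K, ∀ w, ‖iteratedFDeriv ℝ k (𝓕 g) w‖ ≤ C * B * ((1 + ‖w‖) ^ N)⁻¹ := by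
  let J : ℕ → ℝ := fun k => ∫ v : V, ‖v‖ ^ k * Real.exp (-(c * ‖v‖ ^ α))
  have hJ : ∀ k, 0 ≤ J k := fun k => integral_nonneg fun v => by positivity
  let T : ℕ → ℕ → ℝ := fun k n => (2 * Real.pi) ^ k * (2 * k + 2) ^ n *
    ∑ p ∈ Finset.range (k + 1) ×ˢ Finset.range (n + 1), J p.1
  have hT : ∀ k n, 0 ≤ T k n := fun k n =>
    mul_nonneg (by positivity) (Finset.sum_nonneg fun p _ => hJ p.1)
  let S : ℝ := ∑ k ∈ Finset.range (K + 1), (T k 0 + T k N)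
  have hS : 0 ≤ S := Finset.sum_nonneg fun k _ => add_nonneg (hT _ _) (hT _ _)
  refine ⟨2 ^ N * S + 1, by positivity, fun g B hg hB k hk w => ?_⟩
  have hB0 : 0 ≤ B := by
    have := (norm_nonneg _).trans (hB 0 (Nat.zero_le _) 0)
    exact nonneg_of_mul_nonneg_left this (Real.exp_pos _)
  have hint : ∀ k n : ℕ, n ≤ N → Integrable (fun v => ‖v‖ ^ k * ‖iteratedFDeriv ℝ n g v‖) := by
    intro k n hn
    refine ((integrable_norm_pow_mul_exp_neg hc hα k).const_mul B).mono' ?_ ?_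
    · have := hg.continuous_iteratedFDeriv (m := n) (by exact_mod_cast le_top)
      exact Continuous.aestronglyMeasurable (by fun_prop)
    · filter_upwards with v
      rw [Real.norm_of_nonneg (by positivity)]
      calc ‖v‖ ^ k * ‖iteratedFDeriv ℝ n g v‖
          ≤ ‖v‖ ^ k * (B * Real.exp (-(c * ‖v‖ ^ α))) := by gcongr; exact hB n hn v
        _ = _ := by ring
  have hle : ∀ k n : ℕ, n ≤ N → ∫ v, ‖v‖ ^ k * ‖iteratedFDeriv ℝ n g v‖ ≤ B * J k := by
    intro k n hn
    rw [← integral_const_mul]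
    refine integral_mono (hint k n hn) ((integrable_norm_pow_mul_exp_neg hc hα k).const_mul B) ?_
    intro v
    calc ‖v‖ ^ k * ‖iteratedFDeriv ℝ n g v‖
        ≤ ‖v‖ ^ k * (B * Real.exp (-(c * ‖v‖ ^ α))) := by gcongr; exact hB n hn v
      _ = _ := by ring
  have hpow : ∀ n ≤ N, ‖w‖ ^ n * ‖iteratedFDeriv ℝ k (𝓕 g) w‖ ≤ B * T k n := by
    intro n hn
    refine (Real.pow_mul_norm_iteratedFDeriv_fourier_le (K := K) (N := N) (hg.of_le ?_)
      (fun k n _ hn => hint k n (by exact_mod_cast hn)) (by exact_mod_cast hk)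
      (by exact_mod_cast hn) w).trans ?_
    · exact_mod_cast le_top
    · calc (2 * Real.pi) ^ k * (2 * (k : ℝ) + 2) ^ n *
            ∑ p ∈ Finset.range (k + 1) ×ˢ Finset.range (n + 1),
              ∫ v, ‖v‖ ^ p.1 * ‖iteratedFDeriv ℝ p.2 g v‖
          ≤ (2 * Real.pi) ^ k * (2 * (k : ℝ) + 2) ^ n *
            ∑ p ∈ Finset.range (k + 1) ×ˢ Finset.range (n + 1), B * J p.1 := by
            gcongr with p hp
            refine hle _ _ ?_
            have := Finset.mem_range.1 (Finset.mem_product.1 hp).2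
            omega
        _ = B * T k n := by
            rw [← Finset.mul_sum]
            simp only [T]
            ring
  have hTS : T k 0 + T k N ≤ S :=
    Finset.single_le_sum (f := fun k => T k 0 + T k N)
      (fun k _ => add_nonneg (hT _ _) (hT _ _)) (Finset.mem_range.2 (by omega))
  rw [← div_eq_mul_inv, le_div_iff₀ (by positivity), mul_comm]
  have h2 : (1 + ‖w‖) ^ N ≤ 2 ^ N * (1 + ‖w‖ ^ N) := by
    refine (add_pow_le zero_le_one (norm_nonneg w) N).trans ?_
    rw [one_pow]
    gcongr
    · norm_num
    · omega
  have h0 := hpow 0 (Nat.zero_le _)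
  have hN := hpow N le_rfl
  rw [pow_zero, one_mul] at h0
  calc (1 + ‖w‖) ^ N * ‖iteratedFDeriv ℝ k (𝓕 g) w‖
      ≤ 2 ^ N * (1 + ‖w‖ ^ N) * ‖iteratedFDeriv ℝ k (𝓕 g) w‖ := by gcongr
    _ = 2 ^ N * (‖iteratedFDeriv ℝ k (𝓕 g) w‖ + ‖w‖ ^ N * ‖iteratedFDeriv ℝ k (𝓕 g) w‖) := by ring
    _ ≤ 2 ^ N * (B * T k 0 + B * T k N) := by gcongr
    _ = 2 ^ N * B * (T k 0 + T k N) := by ring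
    _ ≤ 2 ^ N * B * S := by gcongr
    _ ≤ (2 ^ N * S + 1) * B := by nlinarith

lemma integrable_norm_pow_mul_of_le_exp [Nontrivial V] {c α B : ℝ} (hc : 0 < c) (hα : 0 < α)
    {g : V → ℂ} (hgm : AEStronglyMeasurable g)
    (hB : ∀ v, ‖g v‖ ≤ B * Real.exp (-(c * ‖v‖ ^ α))) (n : ℕ) :
    Integrable (fun v => ‖v‖ ^ n * ‖g v‖) := by
  refine ((integrable_norm_pow_mul_exp_neg hc hα n).const_mul B).mono' ?_ ?_
  · exact (Continuous.aestronglyMeasurable (by fun_prop)).mul hgm.norm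
  · filter_upwards with v
    rw [Real.norm_of_nonneg (by positivity)]
    calc ‖v‖ ^ n * ‖g v‖ ≤ ‖v‖ ^ n * (B * Real.exp (-(c * ‖v‖ ^ α))) := by gcongr; exact hB v
      _ = _ := by ring

/-- Bounding the convolution pointwise and integrating in `y` first decouples `𝓕 g` from `P`. Of the
`finrank + 2` powers of decay, one absorbs the weight and the other `finrank + 1` are integrable. -/
lemma exists_weighted_bound [Nontrivial V] {c α : ℝ} (hc : 0 < c) (hα : 0 < α) (K : ℕ) :
    ∃ C : ℝ, 0 < C ∧ ∀ (g : V → ℂ) (B : ℝ), ContDiff ℝ ∞ g →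
      (∀ n ≤ Module.finrank ℝ V + 2, ∀ v,
        ‖iteratedFDeriv ℝ n g v‖ ≤ B * Real.exp (-(c * ‖v‖ ^ α))) →
      ∀ (P : Measure V) [IsProbabilityMeasure P] (γ : ℝ), 0 ≤ γ → γ ≤ 1 → ∀ k ≤ K,
      ∫⁻ y, ENNReal.ofReal (‖y‖ ^ γ * ‖iteratedFDeriv ℝ k (𝓕 (fun v => charFun P v * g v)) y‖) ≤
        ENNReal.ofReal (C * B) * (1 + ∫⁻ w, ENNReal.ofReal (‖w‖ ^ γ) ∂P) := by
  obtain ⟨C, hC, hdec⟩ := exists_fourier_decay (V := V) hc hα K (Module.finrank ℝ V + 2)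
  set d := Module.finrank ℝ V with hd
  let ψ : V → ENNReal := fun z => ENNReal.ofReal (((1 + ‖z‖) ^ (d + 1))⁻¹)
  have hψm : Measurable ψ := by
    have : Measurable fun z : V => ((1 + ‖z‖) ^ (d + 1))⁻¹ := by fun_prop
    exact this.ennreal_ofReal
  have hψ : ∫⁻ z, ψ z ≠ ⊤ := by
    have h := integrable_one_add_norm (E := V) (μ := volume) (r := (d + 1 : ℕ)) (by
      push_cast; linarith)
    have h' : Integrable fun z : V => ((1 + ‖z‖) ^ (d + 1))⁻¹ := by
      refine h.congr (Filter.Eventually.of_forall fun z => ?_)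
      simp only
      rw [Real.rpow_neg (by positivity), Real.rpow_natCast]
    exact (h'.lintegral_lt_top).ne
  set J := (∫⁻ z, ψ z).toReal with hJ
  refine ⟨C * (J + 1), by positivity, fun g B hg hB P _ γ hγ0 hγ1 k hk => ?_⟩
  have hB0 : 0 ≤ B := by
    have := (norm_nonneg _).trans (hB 0 (Nat.zero_le _) 0)
    exact nonneg_of_mul_nonneg_left this (Real.exp_pos _)
  have hgc := hg.continuous
  have hgn : ∀ n : ℕ, Integrable (fun v => ‖v‖ ^ n * ‖g v‖) := fun n =>
    integrable_norm_pow_mul_of_le_exp hc hα hgc.aestronglyMeasurable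
      (fun v => by simpa using hB 0 (Nat.zero_le _) v) n
  have hpt : ∀ y, ENNReal.ofReal
      (‖y‖ ^ γ * ‖iteratedFDeriv ℝ k (𝓕 (fun v => charFun P v * g v)) y‖) ≤
      ∫⁻ w, ENNReal.ofReal (C * B) * (ψ (y - (2 * Real.pi)⁻¹ • w) *
        (1 + ENNReal.ofReal (‖w‖ ^ γ))) ∂P := by
    intro y
    rw [iteratedFDeriv_fourier_charFun_mul P hgn hgc.aestronglyMeasurable,
      ENNReal.ofReal_mul (by positivity), ofReal_norm]
    grw [enorm_integral_le_lintegral_enorm]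
    rw [← lintegral_const_mul' _ _ ENNReal.ofReal_ne_top]
    refine lintegral_mono fun w => ?_
    set z := y - (2 * Real.pi)⁻¹ • w with hz
    -- The weight is split along `y = z + w / 2π` by subadditivity, with `‖z‖^γ ≤ 1 + ‖z‖` since `γ
    -- ≤ 1`.
    have hy : ‖y‖ ^ γ ≤ (1 + ‖z‖) * (1 + ‖w‖ ^ γ) := by
      have h1 : y = z + (2 * Real.pi)⁻¹ • w := by rw [hz]; abel
      have h2 : ‖(2 * Real.pi)⁻¹ • w‖ ≤ ‖w‖ := by
        rw [norm_smul, Real.norm_of_nonneg (by positivity)]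
        refine mul_le_of_le_one_left (norm_nonneg _) (inv_le_one_of_one_le₀ ?_)
        linarith [Real.pi_gt_three]
      have h3 : ‖z‖ ^ γ ≤ 1 + ‖z‖ := by
        calc ‖z‖ ^ γ ≤ (1 + ‖z‖) ^ γ := by gcongr; linarith
          _ ≤ (1 + ‖z‖) ^ (1 : ℝ) :=
            Real.rpow_le_rpow_of_exponent_le (by linarith [norm_nonneg z]) hγ1
          _ = 1 + ‖z‖ := Real.rpow_one _
      have h4 : ‖(2 * Real.pi)⁻¹ • w‖ ^ γ ≤ ‖w‖ ^ γ := by gcongr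
      have h5 := norm_add_rpow_le hγ0 hγ1 z ((2 * Real.pi)⁻¹ • w)
      rw [← h1] at h5
      have h6 : 0 ≤ ‖w‖ ^ γ := by positivity
      nlinarith [norm_nonneg z]
    rw [← ofReal_norm, ← ENNReal.ofReal_one, ← ENNReal.ofReal_add (by positivity) (by positivity)]
    simp only [ψ]
    rw [← ENNReal.ofReal_mul (by positivity), ← ENNReal.ofReal_mul (by positivity),
      ← ENNReal.ofReal_mul (by positivity)]
    apply ENNReal.ofReal_le_ofReal
    calc ‖y‖ ^ γ * ‖iteratedFDeriv ℝ k (𝓕 g) z‖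
        ≤ ((1 + ‖z‖) * (1 + ‖w‖ ^ γ)) * (C * B * ((1 + ‖z‖) ^ (d + 2))⁻¹) := by
          gcongr
          exact hdec g B hg hB k hk z
      _ = _ := by
          have : 1 + ‖z‖ ≠ 0 := by positivity
          field_simp
          ring
  calc ∫⁻ y, ENNReal.ofReal (‖y‖ ^ γ *
        ‖iteratedFDeriv ℝ k (𝓕 (fun v => charFun P v * g v)) y‖)
      ≤ ∫⁻ y, ∫⁻ w, ENNReal.ofReal (C * B) * (ψ (y - (2 * Real.pi)⁻¹ • w) *
        (1 + ENNReal.ofReal (‖w‖ ^ γ))) ∂P := lintegral_mono hpt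
    _ = ∫⁻ w, (∫⁻ y, ENNReal.ofReal (C * B) * (ψ (y - (2 * Real.pi)⁻¹ • w) *
        (1 + ENNReal.ofReal (‖w‖ ^ γ)))) ∂P := by
        refine lintegral_lintegral_swap ?_
        refine Measurable.aemeasurable ?_
        unfold Function.uncurry
        fun_prop
    _ = ∫⁻ w, ENNReal.ofReal (C * B) * ((∫⁻ z, ψ z) * (1 + ENNReal.ofReal (‖w‖ ^ γ))) ∂P := by
        refine lintegral_congr fun w => ?_
        rw [lintegral_const_mul' _ _ ENNReal.ofReal_ne_top, lintegral_mul_const' _ _ (by simp),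
          lintegral_sub_right_eq_self]
    _ = ENNReal.ofReal (C * B) * ((∫⁻ z, ψ z) * (1 + ∫⁻ w, ENNReal.ofReal (‖w‖ ^ γ) ∂P)) := by
        rw [lintegral_const_mul' _ _ ENNReal.ofReal_ne_top, lintegral_const_mul' _ _ hψ,
          lintegral_add_left measurable_const]
        simp
    _ ≤ _ := by
        rw [← mul_assoc, ← ENNReal.ofReal_toReal hψ, ← hJ, ← ENNReal.ofReal_mul (by positivity)]
        gcongr ?_ * _
        apply ENNReal.ofReal_le_ofReal
        have : 0 ≤ C * B := by positivity
        nlinarith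

end WeightedBound

/-! ### Splitting a Lévy measure at the unit ball. -/

section LevyMeasure

open VectorFourier FourierTransform

variable {V : Type*} [NormedAddCommGroup V] [InnerProductSpace ℝ V] [FiniteDimensional ℝ V]
  [MeasurableSpace V] [BorelSpace V] {ν : Measure V}

lemma integrable_exp_I_mul_inner_sub_one (hν : Integrable (fun y => min 1 ‖y‖) ν) (ξ : V) :
    Integrable (fun y => Complex.exp (Complex.I * ((inner ℝ ξ y : ℝ) : ℂ)) - 1) ν := by
  refine (hν.const_mul (2 + ‖ξ‖)).mono' (Continuous.aestronglyMeasurable (by fun_prop)) ?_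
  filter_upwards with y
  rcases le_total 1 ‖y‖ with h | h
  · rw [min_eq_left h]
    linarith [norm_exp_I_mul_inner_sub_one_le_two ξ y, norm_nonneg ξ]
  · rw [min_eq_right h]
    nlinarith [norm_exp_I_mul_inner_sub_one_le ξ y, norm_nonneg y]

lemma levyExponent_eq_add (hν : Integrable (fun y => min 1 ‖y‖) ν) {s : Set V}
    (hs : MeasurableSet s) (ξ : V) :
    levyExponent ν ξ = levyExponent (ν.restrict s) ξ + levyExponent (ν.restrict sᶜ) ξ :=
  (integral_add_compl hs (integrable_exp_I_mul_inner_sub_one hν ξ)).symm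

lemma isFiniteMeasure_restrict_compl_closedBall (hν : Integrable (fun y => min 1 ‖y‖) ν) {ε : ℝ}
    (hε : 0 < ε) : IsFiniteMeasure (ν.restrict (Metric.closedBall 0 ε)ᶜ) := by
  refine ⟨?_⟩
  rw [Measure.restrict_apply_univ]
  refine (measure_mono ?_).trans_lt (hν.measure_ge_lt_top (ε := min 1 ε) (by positivity))
  intro y hy
  simp only [mem_compl_iff, mem_closedBall_zero_iff, not_le] at hy
  exact min_le_min_left _ hy.le

lemma integrable_norm_restrict_closedBall (hν : Integrable (fun y => min 1 ‖y‖) ν) :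
    Integrable (fun y => ‖y‖) (ν.restrict (Metric.closedBall 0 1)) := by
  refine (hν.restrict (s := Metric.closedBall 0 1)).congr ?_
  filter_upwards [ae_restrict_mem Metric.isClosed_closedBall.measurableSet] with y hy
  exact min_eq_right (mem_closedBall_zero_iff.1 hy)

lemma ae_norm_le_restrict_closedBall (ν : Measure V) :
    ∀ᵐ y ∂ν.restrict (Metric.closedBall 0 1), ‖y‖ ≤ 1 := by
  filter_upwards [ae_restrict_mem Metric.isClosed_closedBall.measurableSet] with y hy
  exact mem_closedBall_zero_iff.1 hy

lemma continuous_exp_levyExponent (hν : Integrable (fun y => min 1 ‖y‖) ν) :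
    Continuous (fun ξ => Complex.exp (levyExponent ν ξ)) := by
  have := isFiniteMeasure_restrict_compl_closedBall hν one_pos
  have h : (fun ξ => Complex.exp (levyExponent ν ξ)) = fun ξ =>
      Complex.exp (levyExponent (ν.restrict (Metric.closedBall 0 1)) ξ) *
        charFun (compoundPoisson (ν.restrict (Metric.closedBall 0 1)ᶜ)) ξ := by
    ext ξ
    rw [charFun_compoundPoisson', ← Complex.exp_add,
      ← levyExponent_eq_add hν Metric.isClosed_closedBall.measurableSet]
  rw [h]
  exact ((contDiff_levyExponent (integrable_norm_restrict_closedBall hν)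
    (ae_norm_le_restrict_closedBall ν)).continuous.cexp).mul
      (continuous_charFun_of_isFiniteMeasure _)

/-- Removing the jumps of size at most `1 / (n + 1)` leaves a finite measure, hence a compound
Poisson law; the exponents converge because the integrand vanishes at the origin. -/
lemma fourier_exp_levyExponent_re_nonneg (hν : Integrable (fun y => min 1 ‖y‖) ν)
    (hf : Integrable (fun ξ => Complex.exp (levyExponent ν ξ))) (y : V) :
    0 ≤ (𝓕 (fun ξ => Complex.exp (levyExponent ν ξ)) y).re := by
  have hfin : ∀ n : ℕ, IsFiniteMeasure
      (ν.restrict (Metric.closedBall (0 : V) (1 / ((n : ℝ) + 1)))ᶜ) := fun n =>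
    isFiniteMeasure_restrict_compl_closedBall hν (by positivity)
  refine fourier_re_nonneg_of_tendsto_charFun
    (P := fun n : ℕ => compoundPoisson
      (ν.restrict (Metric.closedBall (0 : V) (1 / ((n : ℝ) + 1)))ᶜ)) hf (fun v => ?_) y
  simp_rw [charFun_compoundPoisson']
  refine (Complex.continuous_exp.tendsto _).comp ?_
  have hU : ⋃ n : ℕ, (Metric.closedBall (0 : V) (1 / ((n : ℝ) + 1)))ᶜ = {0}ᶜ := by
    ext z
    simp only [mem_iUnion, mem_compl_iff, mem_closedBall_zero_iff, not_le, mem_singleton_iff]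
    constructor
    · rintro ⟨n, hn⟩ rfl
      rw [norm_zero] at hn
      have : (0 : ℝ) < 1 / ((n : ℝ) + 1) := by positivity
      linarith
    · intro hz
      exact exists_nat_one_div_lt (norm_pos_iff.2 hz)
  have hint := integrable_exp_I_mul_inner_sub_one hν v
  have ht := tendsto_setIntegral_of_monotone (μ := ν)
    (s := fun n : ℕ => (Metric.closedBall (0 : V) (1 / ((n : ℝ) + 1)))ᶜ)
    (fun n => Metric.isClosed_closedBall.measurableSet.compl)
    (fun m n hmn => compl_subset_compl.2 (Metric.closedBall_subset_closedBall
      (one_div_le_one_div_of_le (by positivity) (by simpa using hmn)))) hint.integrableOn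
  rw [hU, setIntegral_eq_integral_of_forall_compl_eq_zero (by simp)] at ht
  exact ht

/-- Discarding the large jumps thus costs at most a factor `e^{2M}` in the decay of `exp Ψ`. -/
lemma levyExponent_re_restrict_compl_ge {M : ℝ}
    (hν : Integrable (fun y => min 1 ‖y‖) ν) (hM : ν.real (Metric.closedBall 0 1)ᶜ ≤ M) (ξ : V) :
    -(2 * M) ≤ (levyExponent (ν.restrict (Metric.closedBall 0 1)ᶜ) ξ).re := by
  have := isFiniteMeasure_restrict_compl_closedBall hν one_pos
  have h : ‖levyExponent (ν.restrict (Metric.closedBall 0 1)ᶜ) ξ‖ ≤ 2 * M := by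
    refine (norm_integral_le_of_norm_le_const (C := 2) (Filter.Eventually.of_forall fun y =>
      norm_exp_I_mul_inner_sub_one_le_two ξ y)).trans ?_
    rw [measureReal_restrict_apply_univ]
    linarith
  exact (abs_le.1 ((Complex.abs_re_le_norm _).trans h)).1

/-- The exponential of the small jumps plays the role of `g`, the compound Poisson law of the large
jumps that of `P`. Only `c` and the three quantities bounded by `M` enter, which gives uniformity in
`ν`. -/
lemma exists_weighted_bound_levy [Nontrivial V] {c α : ℝ} (hc : 0 < c) (hα : 0 < α) (K : ℕ)
    {γ : ℝ} (hγ0 : 0 ≤ γ) (hγ1 : γ ≤ 1) (M : ℝ) :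
    ∃ C : ℝ, 0 < C ∧ ∀ ν : Measure V, Integrable (fun y => min 1 ‖y‖) ν →
      ∫ y in Metric.closedBall 0 1, ‖y‖ ∂ν ≤ M → ν.real (Metric.closedBall 0 1)ᶜ ≤ M →
      ∫⁻ y in (Metric.closedBall 0 1)ᶜ, ENNReal.ofReal (‖y‖ ^ γ) ∂ν ≤ ENNReal.ofReal M →
      (∀ ξ, (levyExponent ν ξ).re ≤ -(c * ‖ξ‖ ^ α)) → ∀ k ≤ K,
      ∫⁻ y, ENNReal.ofReal (‖y‖ ^ γ *
        ‖iteratedFDeriv ℝ k (𝓕 (fun ξ => Complex.exp (levyExponent ν ξ))) y‖) ≤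
          ENNReal.ofReal C := by
  obtain ⟨C, hC, h⟩ := exists_weighted_bound (V := V) hc hα K
  set N := Module.finrank ℝ V + 2 with hN
  set M' := max 1 M with hM'
  have hM'1 : 1 ≤ M' := le_max_left _ _
  set B := N.factorial * Real.exp (2 * M) * M' ^ N with hB
  -- One unit comes from the weighted bound, one from the moment bound that includes `γ = 0`; the
  -- absolute value keeps the constant positive for every `M`.
  refine ⟨C * B * (2 + |M|), by positivity, fun ν hν hs hb hγ hre k hk => ?_⟩
  have hfin := isFiniteMeasure_restrict_compl_closedBall hν one_pos
  have hκ := integrable_norm_restrict_closedBall hν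
  have hκb := ae_norm_le_restrict_closedBall ν
  have hf : (fun ξ => Complex.exp (levyExponent ν ξ)) = fun ξ =>
      charFun (compoundPoisson (ν.restrict (Metric.closedBall 0 1)ᶜ)) ξ *
      Complex.exp (levyExponent (ν.restrict (Metric.closedBall 0 1)) ξ) := by
    ext ξ
    rw [charFun_compoundPoisson', ← Complex.exp_add, add_comm,
      ← levyExponent_eq_add hν Metric.isClosed_closedBall.measurableSet]
  rw [hf]
  have key := h (fun ξ => Complex.exp (levyExponent (ν.restrict (Metric.closedBall 0 1)) ξ)) B
    (contDiff_levyExponent hκ hκb).cexp ?_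
    (compoundPoisson (ν.restrict (Metric.closedBall 0 1)ᶜ)) γ hγ0 hγ1 k hk
  · refine key.trans ?_
    grw [lintegral_norm_rpow_compoundPoisson_le_one_add hγ0 hγ1, hγ]
    rw [ENNReal.ofReal_mul (p := C * B) (by positivity)]
    gcongr
    rw [ENNReal.ofReal_add (by norm_num) (abs_nonneg _), ← add_assoc, one_add_one_eq_two,
      ENNReal.ofReal_ofNat]
    gcongr
    exact le_abs_self M
  · intro n hn v
    refine (norm_iteratedFDeriv_cexp_levyExponent_le hκ hκb hM'1 (hs.trans (le_max_right _ _))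
      n v).trans ?_
    have h1 : (levyExponent (ν.restrict (Metric.closedBall 0 1)) v).re ≤
        2 * M + -(c * ‖v‖ ^ α) := by
      have h2 := levyExponent_re_restrict_compl_ge hν hb v
      have h3 := hre v
      rw [levyExponent_eq_add hν Metric.isClosed_closedBall.measurableSet (s := Metric.closedBall 0 1),
        Complex.add_re] at h3
      linarith
    calc (n.factorial : ℝ) * Real.exp (levyExponent (ν.restrict (Metric.closedBall 0 1)) v).re *
          M' ^ n
        ≤ N.factorial * Real.exp (2 * M + -(c * ‖v‖ ^ α)) * M' ^ N := by
          gcongr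
      _ = B * Real.exp (-(c * ‖v‖ ^ α)) := by
          rw [Real.exp_add, hB]
          ring

end LevyMeasure

/-! ### The radial measure and its moments. -/

/-- The radial part `ρ^(-1-α) dρ` of the stable Lévy measure. -/
def radialMeasure (α : ℝ) : Measure ℝ :=
  (volume.restrict (Ioi (0 : ℝ))).withDensity (fun ρ => ENNReal.ofReal (ρ ^ (-(1 + α))))

instance sFinite_radialMeasure (α : ℝ) : SFinite (radialMeasure α) := by
  unfold radialMeasure; infer_instance

lemma measurable_ofReal_rpow_const (p : ℝ) :
    Measurable fun ρ : ℝ => ENNReal.ofReal (ρ ^ p) := by fun_prop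

lemma lintegral_radialMeasure (α : ℝ) {g : ℝ → ENNReal} (hg : Measurable g) :
    ∫⁻ ρ, g ρ ∂radialMeasure α = ∫⁻ ρ in Ioi 0, ENNReal.ofReal (ρ ^ (-(1 + α))) * g ρ := by
  rw [radialMeasure, lintegral_withDensity_eq_lintegral_mul _ (measurable_ofReal_rpow_const _) hg]
  rfl

lemma integral_radialMeasure {F : Type*} [NormedAddCommGroup F] [NormedSpace ℝ F] (α : ℝ)
    (g : ℝ → F) :
    ∫ ρ, g ρ ∂radialMeasure α = ∫ ρ in Ioi 0, ρ ^ (-(1 + α)) • g ρ := by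
  rw [radialMeasure, integral_withDensity_eq_integral_toReal_smul (measurable_ofReal_rpow_const _)
    (by simp)]
  refine setIntegral_congr_fun measurableSet_Ioi fun ρ hρ => ?_
  rw [ENNReal.toReal_ofReal (Real.rpow_nonneg (le_of_lt hρ) _)]

lemma ae_pos_radialMeasure (α : ℝ) : ∀ᵐ ρ ∂radialMeasure α, 0 < ρ :=
  (withDensity_absolutelyContinuous _ _).ae_le (ae_restrict_mem measurableSet_Ioi)

lemma lintegral_radialMeasure_Iic_one {α : ℝ} (h1 : α < 1) :
    ∫⁻ ρ in Iic 1, ENNReal.ofReal ρ ∂radialMeasure α = ENNReal.ofReal (1 / (1 - α)) := by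
  rw [← lintegral_indicator measurableSet_Iic, lintegral_radialMeasure α
    (ENNReal.measurable_ofReal.indicator measurableSet_Iic)]
  have h : ∀ ρ : ℝ, ENNReal.ofReal (ρ ^ (-(1 + α))) * (Iic 1).indicator ENNReal.ofReal ρ =
      (Iic 1).indicator (fun ρ => ENNReal.ofReal (ρ ^ (-(1 + α))) * ENNReal.ofReal ρ) ρ := by
    intro ρ
    by_cases hρ : ρ ∈ Iic (1 : ℝ) <;> simp [hρ, indicator]
  simp_rw [h]
  rw [lintegral_indicator measurableSet_Iic, Measure.restrict_restrict measurableSet_Iic,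
    inter_comm, Ioi_inter_Iic]
  have hi : IntervalIntegrable (fun ρ : ℝ => ρ ^ (-α)) volume 0 1 :=
    intervalIntegral.intervalIntegrable_rpow' (by linarith)
  have he : ∫⁻ ρ in Ioc (0 : ℝ) 1, ENNReal.ofReal (ρ ^ (-(1 + α))) * ENNReal.ofReal ρ =
      ∫⁻ ρ in Ioc (0 : ℝ) 1, ENNReal.ofReal (ρ ^ (-α)) := by
    refine setLIntegral_congr_fun measurableSet_Ioc fun ρ hρ => ?_
    rw [← ENNReal.ofReal_mul (Real.rpow_nonneg hρ.1.le _)]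
    congr 1
    nth_rw 2 [← Real.rpow_one ρ]
    rw [← Real.rpow_add hρ.1]
    congr 1
    ring
  rw [he, ← ofReal_integral_eq_lintegral_ofReal
    ((intervalIntegrable_iff_integrableOn_Ioc_of_le zero_le_one).1 hi)
    ((ae_restrict_mem measurableSet_Ioc).mono fun ρ hρ => Real.rpow_nonneg hρ.1.le _),
    ← intervalIntegral.integral_of_le zero_le_one, integral_rpow (Or.inl (by linarith))]
  congr 1
  rw [Real.one_rpow, Real.zero_rpow (by linarith)]
  ring

lemma lintegral_radialMeasure_Ioi_one {α γ : ℝ} (h : γ < α) :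
    ∫⁻ ρ in Ioi 1, ENNReal.ofReal (ρ ^ γ) ∂radialMeasure α = ENNReal.ofReal (1 / (α - γ)) := by
  rw [← lintegral_indicator measurableSet_Ioi, lintegral_radialMeasure α
    ((measurable_ofReal_rpow_const γ).indicator measurableSet_Ioi)]
  have h' : ∀ ρ : ℝ, ENNReal.ofReal (ρ ^ (-(1 + α))) *
      (Ioi 1).indicator (fun ρ => ENNReal.ofReal (ρ ^ γ)) ρ =
      (Ioi 1).indicator (fun ρ => ENNReal.ofReal (ρ ^ (-(1 + α))) * ENNReal.ofReal (ρ ^ γ)) ρ := by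
    intro ρ
    by_cases hρ : ρ ∈ Ioi (1 : ℝ) <;> simp [hρ, indicator]
  simp_rw [h']
  rw [lintegral_indicator measurableSet_Ioi, Measure.restrict_restrict measurableSet_Ioi,
    inter_eq_left.2 (Ioi_subset_Ioi zero_le_one)]
  have he : ∫⁻ ρ in Ioi (1 : ℝ), ENNReal.ofReal (ρ ^ (-(1 + α))) * ENNReal.ofReal (ρ ^ γ) =
      ∫⁻ ρ in Ioi (1 : ℝ), ENNReal.ofReal (ρ ^ (γ - α - 1)) := by
    refine setLIntegral_congr_fun measurableSet_Ioi fun ρ hρ => ?_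
    have hρ0 : (0 : ℝ) < ρ := zero_lt_one.trans hρ
    rw [← ENNReal.ofReal_mul (Real.rpow_nonneg hρ0.le _), ← Real.rpow_add hρ0]
    congr 2
    ring
  rw [he, ← ofReal_integral_eq_lintegral_ofReal
    (integrableOn_Ioi_rpow_of_lt (by linarith) one_pos)
    ((ae_restrict_mem measurableSet_Ioi).mono fun ρ hρ =>
      Real.rpow_nonneg (zero_le_one.trans (le_of_lt hρ)) _),
    integral_Ioi_rpow_of_lt (by linarith) one_pos]
  congr 1
  rw [Real.one_rpow, show γ - α - 1 + 1 = -(α - γ) by ring, neg_div_neg_eq]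

/-- Integrability at the origin uses `α < 1`, at infinity `0 < α`. -/
lemma integrable_min_one_radialMeasure {α : ℝ} (hα : α ∈ Ioo (0 : ℝ) 1) :
    Integrable (fun ρ => min 1 ρ) (radialMeasure α) := by
  refine ⟨Continuous.aestronglyMeasurable (by fun_prop), ?_⟩
  rw [hasFiniteIntegral_iff_ofReal
    ((ae_pos_radialMeasure α).mono fun ρ hρ => le_min zero_le_one hρ.le),
    ← lintegral_add_compl _ (measurableSet_Iic (a := (1 : ℝ)))]
  refine ENNReal.add_lt_top.2 ⟨?_, ?_⟩
  · rw [setLIntegral_congr_fun (g := fun ρ => ENNReal.ofReal ρ) measurableSet_Iic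
      (fun ρ hρ => by simp only [min_eq_right (show ρ ≤ 1 from hρ)]),
      lintegral_radialMeasure_Iic_one hα.2]
    exact ENNReal.ofReal_lt_top
  · rw [compl_Iic, setLIntegral_congr_fun (g := fun ρ => ENNReal.ofReal (ρ ^ (0 : ℝ)))
      measurableSet_Ioi (fun ρ hρ => by simp [min_eq_left (show (1 : ℝ) ≤ ρ from le_of_lt hρ)]),
      lintegral_radialMeasure_Ioi_one hα.1]
    exact ENNReal.ofReal_lt_top

lemma one_sub_cos_le_two_mul_min {ρ : ℝ} (hρ : 0 < ρ) : 1 - Real.cos ρ ≤ 2 * min 1 ρ := by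
  rcases le_total 1 ρ with h | h
  · rw [min_eq_left h]
    linarith [Real.neg_one_le_cos ρ]
  · rw [min_eq_right h]
    nlinarith [Real.one_sub_sq_div_two_le_cos (x := ρ)]

lemma integrableOn_one_sub_cos_mul_rpow {α : ℝ} (hα : α ∈ Ioo (0 : ℝ) 1) :
    IntegrableOn (fun r => (1 - Real.cos r) * r ^ (-(1 + α))) (Ioi 0) := by
  have h : Integrable (fun r => 1 - Real.cos r) (radialMeasure α) := by
    refine ((integrable_min_one_radialMeasure hα).const_mul 2).mono'
      (Continuous.aestronglyMeasurable (by fun_prop)) ?_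
    filter_upwards [ae_pos_radialMeasure α] with ρ hρ
    rw [Real.norm_of_nonneg (by linarith [Real.cos_le_one ρ])]
    exact one_sub_cos_le_two_mul_min hρ
  rw [radialMeasure, integrable_withDensity_iff (measurable_ofReal_rpow_const _) (by simp)] at h
  refine IntegrableOn.congr_fun h (fun ρ hρ => ?_) measurableSet_Ioi
  rw [ENNReal.toReal_ofReal (Real.rpow_nonneg (le_of_lt hρ) _)]

lemma spectralConst_pos {α : ℝ} (hα : α ∈ Ioo (0 : ℝ) 1) : 0 < spectralConst α := by
  have hnn : ∀ r ∈ Ioi (0 : ℝ), 0 ≤ (1 - Real.cos r) * r ^ (-(1 + α)) := fun r hr =>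
    mul_nonneg (by linarith [Real.cos_le_one r]) (Real.rpow_nonneg (le_of_lt hr) _)
  rw [spectralConst, setIntegral_pos_iff_support_of_nonneg_ae
    ((ae_restrict_mem measurableSet_Ioi).mono hnn) (integrableOn_one_sub_cos_mul_rpow hα)]
  refine lt_of_lt_of_le (b := volume (Ioo (0 : ℝ) 1)) (by simp) (measure_mono ?_)
  intro r hr
  refine ⟨?_, hr.1⟩
  have h1 : Real.cos r < 1 := by
    have := Real.cos_lt_cos_of_nonneg_of_le_pi le_rfl
      (by linarith [hr.2, Real.pi_gt_three]) hr.1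
    rwa [Real.cos_zero] at this
  have h2 : 0 < r ^ (-(1 + α)) := Real.rpow_pos_of_pos hr.1 _
  exact (mul_pos (by linarith) h2).ne'

/-- Substitution `r = |a| ρ`, using that the cosine is even. -/
lemma integral_one_sub_cos_radialMeasure {α : ℝ} (hα : α ∈ Ioo (0 : ℝ) 1) (a : ℝ) :
    ∫ ρ, (1 - Real.cos (ρ * a)) ∂radialMeasure α = |a| ^ α * spectralConst α := by
  rw [integral_radialMeasure]
  rcases eq_or_ne a 0 with rfl | ha
  · simp [Real.zero_rpow hα.1.ne']
  have hb : 0 < |a| := abs_pos.2 ha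
  have h := integral_comp_mul_left_Ioi (fun r => (1 - Real.cos r) * r ^ (-(1 + α))) 0 hb
  rw [mul_zero, ← spectralConst] at h
  have h2 : ∫ ρ in Ioi (0 : ℝ), (1 - Real.cos (|a| * ρ)) * (|a| * ρ) ^ (-(1 + α)) =
      |a| ^ (-(1 + α)) * ∫ ρ in Ioi (0 : ℝ), ρ ^ (-(1 + α)) • (1 - Real.cos (ρ * a)) := by
    rw [← integral_const_mul]
    refine setIntegral_congr_fun measurableSet_Ioi fun ρ hρ => ?_
    simp only [smul_eq_mul]
    have hc : Real.cos (|a| * ρ) = Real.cos (ρ * a) := by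
      rw [← Real.cos_abs (ρ * a), abs_mul, abs_of_pos (show 0 < ρ from hρ), mul_comm]
    rw [hc, Real.mul_rpow hb.le (le_of_lt hρ)]
    ring
  rw [h2] at h
  have h3 : |a| ^ (-(1 + α)) ≠ 0 := (Real.rpow_pos_of_pos hb _).ne'
  rw [← mul_right_inj' h3, h, smul_eq_mul, ← mul_assoc, ← Real.rpow_add hb, ← Real.rpow_neg_one]
  congr 2
  ring

/-! ### The stable Lévy measure, its symbol and its mass. -/

section StableLevyMeasure

variable {d : ℕ} {α : ℝ}

lemma stableLevyMeasure_eq_map (m : Measure (UnitSphere d)) :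
    stableLevyMeasure α m = Measure.map
      (fun q : ℝ × UnitSphere d => q.1 • (q.2 : EuclideanSpace ℝ (Fin d)))
      ((radialMeasure α).prod m) := rfl

lemma measurable_polar :
    Measurable (fun q : ℝ × UnitSphere d => q.1 • (q.2 : EuclideanSpace ℝ (Fin d))) :=
  measurable_fst.smul (measurable_subtype_coe.comp measurable_snd)

lemma norm_coe_unitSphere (s : UnitSphere d) : ‖(s : EuclideanSpace ℝ (Fin d))‖ = 1 :=
  norm_eq_of_mem_sphere s

lemma setLIntegral_norm_stableLevyMeasure (m : Measure (UnitSphere d)) [IsFiniteMeasure m]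
    {S : Set ℝ} (hS : MeasurableSet S) {g : ℝ → ENNReal} (hg : Measurable g) :
    ∫⁻ y in norm ⁻¹' S, g ‖y‖ ∂stableLevyMeasure α m =
      m univ * ∫⁻ ρ in S, g ρ ∂radialMeasure α := by
  have hgS : Measurable (S.indicator g) := hg.indicator hS
  have h1 : (norm ⁻¹' S).indicator (fun y : EuclideanSpace ℝ (Fin d) => g ‖y‖) =
      fun y => S.indicator g ‖y‖ := by
    rfl
  rw [← lintegral_indicator (measurable_norm hS), h1, stableLevyMeasure_eq_map,
    lintegral_map (f := fun y : EuclideanSpace ℝ (Fin d) => S.indicator g ‖y‖)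
      (hgS.comp measurable_norm) measurable_polar]
  refine (lintegral_prod_symm
    (fun q : ℝ × UnitSphere d => S.indicator g ‖q.1 • (q.2 : EuclideanSpace ℝ (Fin d))‖)
    ((hgS.comp measurable_norm).comp measurable_polar).aemeasurable).trans ?_
  have h2 : ∀ s : UnitSphere d, ∫⁻ ρ, S.indicator g ‖ρ • (s : EuclideanSpace ℝ (Fin d))‖
      ∂radialMeasure α = ∫⁻ ρ in S, g ρ ∂radialMeasure α := by
    intro s
    rw [← lintegral_indicator hS]
    refine lintegral_congr_ae ?_
    filter_upwards [ae_pos_radialMeasure α] with ρ hρ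
    rw [norm_smul, norm_coe_unitSphere, mul_one, Real.norm_of_nonneg hρ.le]
  simp_rw [h2]
  rw [lintegral_const, mul_comm]

lemma lintegral_norm_stableLevyMeasure (m : Measure (UnitSphere d)) [IsFiniteMeasure m]
    {g : ℝ → ENNReal} (hg : Measurable g) :
    ∫⁻ y, g ‖y‖ ∂stableLevyMeasure α m = m univ * ∫⁻ ρ, g ρ ∂radialMeasure α := by
  simpa using setLIntegral_norm_stableLevyMeasure (α := α) m MeasurableSet.univ hg

lemma integrable_min_one_norm_stableLevyMeasure (hα : α ∈ Ioo (0 : ℝ) 1)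
    (m : Measure (UnitSphere d)) [IsFiniteMeasure m] :
    Integrable (fun y => min 1 ‖y‖) (stableLevyMeasure α m) := by
  refine ⟨Continuous.aestronglyMeasurable (by fun_prop), ?_⟩
  rw [hasFiniteIntegral_iff_ofReal
    (Filter.Eventually.of_forall fun y => le_min zero_le_one (norm_nonneg y)),
    lintegral_norm_stableLevyMeasure m (g := fun ρ => ENNReal.ofReal (min 1 ρ)) (by fun_prop)]
  exact ENNReal.mul_lt_top (measure_lt_top m univ)
    (integrable_min_one_radialMeasure hα).lintegral_lt_top

lemma isFiniteVariationLevyMeasure_stableLevyMeasure (hα : α ∈ Ioo (0 : ℝ) 1)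
    (m : Measure (UnitSphere d)) [IsFiniteMeasure m] :
    IsFiniteVariationLevyMeasure (stableLevyMeasure α m) := by
  refine ⟨?_, (integrable_min_one_norm_stableLevyMeasure hα m).lintegral_lt_top⟩
  have h := setLIntegral_norm_stableLevyMeasure (α := α) m (measurableSet_singleton 0)
    (g := fun _ => 1) measurable_const
  have h0 : radialMeasure α {0} = 0 :=
    (withDensity_absolutelyContinuous _ _) (Measure.restrict_le_self.absolutelyContinuous
      (measure_singleton 0))
  have hs : (norm ⁻¹' {0} : Set (EuclideanSpace ℝ (Fin d))) = {0} := by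
    ext y
    simp
  simpa [hs, h0] using h

lemma closedBall_eq_preimage_norm :
    Metric.closedBall (0 : EuclideanSpace ℝ (Fin d)) 1 = norm ⁻¹' Iic 1 := by
  ext y
  simp

lemma setIntegral_closedBall_stableLevyMeasure (hα : α ∈ Ioo (0 : ℝ) 1)
    (m : Measure (UnitSphere d)) [IsFiniteMeasure m] :
    ∫ y in Metric.closedBall 0 1, ‖y‖ ∂stableLevyMeasure α m = m.real univ * (1 / (1 - α)) := by
  rw [integral_eq_lintegral_of_nonneg_ae (Filter.Eventually.of_forall fun y => norm_nonneg y)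
    continuous_norm.aestronglyMeasurable, closedBall_eq_preimage_norm,
    setLIntegral_norm_stableLevyMeasure m measurableSet_Iic ENNReal.measurable_ofReal,
    lintegral_radialMeasure_Iic_one hα.2, ENNReal.toReal_mul, ENNReal.toReal_ofReal]
  · rfl
  · have := hα.2
    exact div_nonneg zero_le_one (by linarith)

lemma setLIntegral_compl_closedBall_stableLevyMeasure {γ : ℝ} (hγ : γ < α)
    (m : Measure (UnitSphere d)) [IsFiniteMeasure m] :
    ∫⁻ y in (Metric.closedBall 0 1)ᶜ, ENNReal.ofReal (‖y‖ ^ γ) ∂stableLevyMeasure α m =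
      m univ * ENNReal.ofReal (1 / (α - γ)) := by
  rw [closedBall_eq_preimage_norm, ← preimage_compl, compl_Iic,
    setLIntegral_norm_stableLevyMeasure m measurableSet_Ioi (measurable_ofReal_rpow_const γ),
    lintegral_radialMeasure_Ioi_one hγ]

lemma measureReal_compl_closedBall_stableLevyMeasure (hα : 0 < α)
    (m : Measure (UnitSphere d)) [IsFiniteMeasure m] :
    (stableLevyMeasure α m).real (Metric.closedBall 0 1)ᶜ = m.real univ * (1 / α) := by
  have h := setLIntegral_compl_closedBall_stableLevyMeasure (d := d) hα m
  simp only [Real.rpow_zero, ENNReal.ofReal_one, lintegral_const, one_mul, sub_zero,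
    Measure.restrict_apply_univ] at h
  rw [measureReal_def, h, ENNReal.toReal_mul, ENNReal.toReal_ofReal (by positivity)]
  rfl

lemma levySymbol_eq_levyExponent (ν : Measure (EuclideanSpace ℝ (Fin d))) :
    levySymbol ν = levyExponent ν := rfl

lemma spectralIntegral_spectralMeasure (hα : α ∈ Ioo (0 : ℝ) 1) (m : Measure (UnitSphere d))
    (ξ : EuclideanSpace ℝ (Fin d)) :
    spectralIntegral α (spectralMeasure α m) ξ =
      spectralConst α * ∫ s : UnitSphere d,
        |(inner ℝ ξ (s : EuclideanSpace ℝ (Fin d)) : ℝ)| ^ α ∂m := by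
  rw [spectralIntegral, spectralMeasure, integral_smul_measure,
    ENNReal.toReal_ofReal (spectralConst_pos hα).le, smul_eq_mul]

/-- The symbol of a stable operator with symmetric spherical part is minus the integral against
the spectral measure. -/
lemma levySymbol_stableLevyMeasure (hα : α ∈ Ioo (0 : ℝ) 1) (m : Measure (UnitSphere d))
    [IsFiniteMeasure m] (hm : IsSymmetric m) (ξ : EuclideanSpace ℝ (Fin d)) :
    levySymbol (stableLevyMeasure α m) ξ =
      ((-spectralIntegral α (spectralMeasure α m) ξ : ℝ) : ℂ) := by
  have hint := integrable_exp_I_mul_inner_sub_one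
    (integrable_min_one_norm_stableLevyMeasure hα m) ξ
  rw [stableLevyMeasure_eq_map, integrable_map_measure hint.1
    measurable_polar.aemeasurable] at hint
  set H : UnitSphere d → ℂ := fun s => ∫ ρ, (Complex.exp (Complex.I *
    ((inner ℝ ξ (ρ • (s : EuclideanSpace ℝ (Fin d))) : ℝ) : ℂ)) - 1) ∂radialMeasure α with hH
  have hZ : levySymbol (stableLevyMeasure α m) ξ = ∫ s, H s ∂m := by
    rw [levySymbol, stableLevyMeasure_eq_map, integral_map measurable_polar.aemeasurable
      (Continuous.aestronglyMeasurable (by fun_prop))]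
    exact integral_prod_symm _ hint
  have hHi : Integrable H m := hint.integral_prod_right
  have hre : ∀ s : UnitSphere d, (H s).re =
      -(|(inner ℝ ξ (s : EuclideanSpace ℝ (Fin d)) : ℝ)| ^ α * spectralConst α) := by
    intro s
    have hi : Integrable (fun ρ : ℝ => Complex.exp (Complex.I *
        ((inner ℝ ξ (ρ • (s : EuclideanSpace ℝ (Fin d))) : ℝ) : ℂ)) - 1) (radialMeasure α) := by
      refine ((integrable_min_one_radialMeasure hα).const_mul (2 + ‖ξ‖)).mono'
        (Continuous.aestronglyMeasurable (by fun_prop)) ?_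
      filter_upwards [ae_pos_radialMeasure α] with ρ hρ
      have hn : ‖ρ • (s : EuclideanSpace ℝ (Fin d))‖ = ρ := by
        rw [norm_smul, norm_coe_unitSphere, mul_one, Real.norm_of_nonneg hρ.le]
      have h1 := norm_exp_I_mul_inner_sub_one_le ξ (ρ • (s : EuclideanSpace ℝ (Fin d)))
      have h2 := norm_exp_I_mul_inner_sub_one_le_two ξ (ρ • (s : EuclideanSpace ℝ (Fin d)))
      rw [hn] at h1
      rcases le_total 1 ρ with h | h
      · rw [min_eq_left h]
        linarith [norm_nonneg ξ]
      · rw [min_eq_right h]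
        nlinarith [norm_nonneg ξ]
    have h3 : (H s).re = ∫ ρ, (Complex.exp (Complex.I *
        ((inner ℝ ξ (ρ • (s : EuclideanSpace ℝ (Fin d))) : ℝ) : ℂ)) - 1).re ∂radialMeasure α :=
      (integral_re hi).symm
    rw [h3, ← integral_one_sub_cos_radialMeasure hα, ← integral_neg]
    congr 1
    ext1 ρ
    rw [mul_comm, Complex.sub_re, Complex.exp_ofReal_mul_I_re, Complex.one_re, inner_smul_right]
    ring
  -- Conjugation amounts to `s ↦ -s`, so the symmetry of `m` makes the symbol real and only the
  -- cosine part remains.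
  have hconj : ∀ s : UnitSphere d, (starRingEnd ℂ) (H s) = H (-s) := by
    intro s
    simp only [hH]
    rw [← integral_conj]
    congr 1
    ext1 ρ
    rw [map_sub, map_one, ← Complex.exp_conj, map_mul, Complex.conj_I, Complex.conj_ofReal]
    simp
  have hreal : (starRingEnd ℂ) (∫ s, H s ∂m) = ∫ s, H s ∂m := by
    rw [← integral_conj]
    simp_rw [hconj]
    have hmeas : MeasurableEmbedding (fun s : UnitSphere d => -s) :=
      (Homeomorph.neg (UnitSphere d)).measurableEmbedding
    rw [← hmeas.integral_map, hm]
  have h4 : (∫ s, H s ∂m).re = ∫ s, (H s).re ∂m := (integral_re hHi).symm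
  rw [hZ, ← Complex.conj_eq_iff_re.1 hreal, h4, spectralIntegral_spectralMeasure hα]
  simp_rw [hre]
  rw [integral_neg, integral_mul_const, mul_comm]

/-- Since `α < 2` and `|ξ k| ≤ ‖ξ‖`, one has `|ξ k|² ‖ξ‖^(α-2) ≤ |ξ k|^α`; summing over `k` gives
the claim. It serves both the mass bound and the cylindrical example. -/
lemma norm_rpow_le_sum_abs_rpow (hα : α ∈ Ioo (0 : ℝ) 1) (ξ : EuclideanSpace ℝ (Fin d)) :
    ‖ξ‖ ^ α ≤ ∑ k, |ξ k| ^ α := by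
  rcases eq_or_ne ξ 0 with rfl | hξ
  · simp [Real.zero_rpow hα.1.ne']
  have hr : 0 < ‖ξ‖ := norm_pos_iff.2 hξ
  have hk : ∀ k, |ξ k| ^ (2 : ℕ) * ‖ξ‖ ^ (α - 2) ≤ |ξ k| ^ α := by
    intro k
    rcases eq_or_ne (ξ k) 0 with h | h
    · simp [h, Real.zero_rpow hα.1.ne']
    · have h0 : 0 < |ξ k| := abs_pos.2 h
      have h1 : |ξ k| ≤ ‖ξ‖ := by simpa using PiLp.norm_apply_le ξ k
      calc |ξ k| ^ (2 : ℕ) * ‖ξ‖ ^ (α - 2) ≤ |ξ k| ^ (2 : ℕ) * |ξ k| ^ (α - 2) := by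
            gcongr ?_ * ?_
            exact Real.rpow_le_rpow_of_nonpos h0 h1 (by linarith [hα.2])
        _ = |ξ k| ^ α := by
            rw [← Real.rpow_two, ← Real.rpow_add h0]
            congr 1
            ring
  calc ‖ξ‖ ^ α = ‖ξ‖ ^ (2 : ℕ) * ‖ξ‖ ^ (α - 2) := by
        rw [← Real.rpow_two, ← Real.rpow_add hr]
        congr 1
        ring
    _ = ∑ k, |ξ k| ^ (2 : ℕ) * ‖ξ‖ ^ (α - 2) := by
        rw [EuclideanSpace.norm_sq_eq, Finset.sum_mul]
        simp
    _ ≤ _ := Finset.sum_le_sum fun k _ => hk k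

lemma integrable_abs_inner_rpow (hα : 0 < α) (m : Measure (UnitSphere d)) [IsFiniteMeasure m]
    (ξ : EuclideanSpace ℝ (Fin d)) :
    Integrable (fun s : UnitSphere d =>
      |(inner ℝ ξ (s : EuclideanSpace ℝ (Fin d)) : ℝ)| ^ α) m := by
  refine Integrable.of_bound (C := ‖ξ‖ ^ α) ?_ ?_
  · have : Continuous fun s : UnitSphere d => |(inner ℝ ξ (s : EuclideanSpace ℝ (Fin d)) : ℝ)| := by
      fun_prop
    exact (this.rpow_const fun _ => Or.inr hα.le).aestronglyMeasurable
  · filter_upwards with s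
    rw [Real.norm_of_nonneg (by positivity)]
    gcongr
    exact (abs_real_inner_le_norm _ _).trans (by rw [norm_coe_unitSphere, mul_one])

/-- The total mass of the spherical part is controlled by the non-degeneracy constant. -/
lemma measureReal_univ_le_of_nonDegenerate (hα : α ∈ Ioo (0 : ℝ) 1) {η : ℝ}
    (m : Measure (UnitSphere d)) [IsFiniteMeasure m]
    (h : NonDegenerate α η (spectralMeasure α m)) :
    m.real univ ≤ d * η / spectralConst α := by
  rw [le_div_iff₀ (spectralConst_pos hα), mul_comm]
  have hint : ∀ k : Fin d, Integrable (fun s : UnitSphere d => |(inner ℝ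
      (EuclideanSpace.single k (1 : ℝ)) (s : EuclideanSpace ℝ (Fin d)) : ℝ)| ^ α) m :=
    fun k => integrable_abs_inner_rpow hα.1 m _
  -- On the sphere `1 ≤ ∑ |s_k|^α`, so the upper non-degeneracy bound tested on the `d` basis
  -- vectors controls the mass.
  calc spectralConst α * m.real univ
      = spectralConst α * ∫ _ : UnitSphere d, (1 : ℝ) ∂m := by simp
    _ ≤ spectralConst α * ∫ s : UnitSphere d, ∑ k : Fin d, |(inner ℝ
          (EuclideanSpace.single k (1 : ℝ)) (s : EuclideanSpace ℝ (Fin d)) : ℝ)| ^ α ∂m := by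
        refine mul_le_mul_of_nonneg_left ?_ (spectralConst_pos hα).le
        refine integral_mono (integrable_const _) (integrable_finsetSum _ fun k _ => hint k) ?_
        intro s
        have := norm_rpow_le_sum_abs_rpow hα (s : EuclideanSpace ℝ (Fin d))
        rw [norm_coe_unitSphere, Real.one_rpow] at this
        simpa [EuclideanSpace.inner_single_left] using this
    _ = ∑ k : Fin d, spectralIntegral α (spectralMeasure α m) (EuclideanSpace.single k (1 : ℝ)) := by
        rw [integral_finsetSum _ fun k _ => hint k, Finset.mul_sum]
        simp_rw [spectralIntegral_spectralMeasure hα]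
    _ ≤ ∑ _k : Fin d, η := by
        refine Finset.sum_le_sum fun k _ => ?_
        have := (h (EuclideanSpace.single k (1 : ℝ))).2
        simpa using this
    _ = d * η := by simp

end StableLevyMeasure

/-! ### Self-similarity and Fourier inversion for the heat kernel. -/

section HeatKernel

open FourierTransform

variable {d : ℕ} {α : ℝ}

lemma spectralIntegral_smul (μ : Measure (UnitSphere d)) {a : ℝ} (ha : 0 ≤ a)
    (ξ : EuclideanSpace ℝ (Fin d)) :
    spectralIntegral α μ (a • ξ) = a ^ α * spectralIntegral α μ ξ := by
  rw [spectralIntegral, spectralIntegral, ← integral_const_mul]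
  congr 1
  ext1 s
  rw [real_inner_smul_left, abs_mul, abs_of_nonneg ha, Real.mul_rpow ha (abs_nonneg _)]

lemma spectralIntegral_neg (μ : Measure (UnitSphere d)) (ξ : EuclideanSpace ℝ (Fin d)) :
    spectralIntegral α μ (-ξ) = spectralIntegral α μ ξ := by
  simp [spectralIntegral]

/-- The Fourier transform of `exp (-∫ |⟨ξ,s⟩|^α μ(ds))`; the heat kernel is a rescaling of it. -/
def unitKernel (α : ℝ) (μ : Measure (UnitSphere d)) : EuclideanSpace ℝ (Fin d) → ℂ :=
  𝓕 (fun ξ => ((Real.exp (-spectralIntegral α μ ξ) : ℝ) : ℂ))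

/-- The dilation factor relating the heat kernel at time `t` to `unitKernel`. -/
def kernelScale (α t : ℝ) : ℝ := (2 * Real.pi)⁻¹ * t ^ (-α⁻¹)

lemma kernelScale_pos {t : ℝ} (ht : 0 < t) : 0 < kernelScale α t :=
  mul_pos (by positivity) (Real.rpow_pos_of_pos ht _)

/-- The substitution `ξ = t^(-1/α) v` removes `t` from the exponent by homogeneity; its Jacobian and
`(2π)^(-d)` combine to `kernelScale ^ d`. -/
lemma heatKernel_eq (hα : 0 < α) (μ : Measure (UnitSphere d)) {t : ℝ} (ht : 0 < t)
    (y : EuclideanSpace ℝ (Fin d)) :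
    heatKernel α μ t y =
      kernelScale α t ^ d * (unitKernel α μ (kernelScale α t • y)).re := by
  set a := t ^ (-α⁻¹) with ha
  have ha0 : 0 < a := Real.rpow_pos_of_pos ht _
  have hat : t * a ^ α = 1 := by
    rw [ha, ← Real.rpow_mul ht.le, neg_mul, inv_mul_cancel₀ hα.ne', Real.rpow_neg_one,
      mul_inv_cancel₀ ht.ne']
  have h := Measure.integral_comp_smul (volume : Measure (EuclideanSpace ℝ (Fin d)))
    (fun ξ => Complex.exp (-(Complex.I * ((inner ℝ y ξ : ℝ) : ℂ))) *
        ((Real.exp (-(t * spectralIntegral α μ ξ)) : ℝ) : ℂ)) a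
  have hK : unitKernel α μ (kernelScale α t • y) = ∫ v : EuclideanSpace ℝ (Fin d),
      Complex.exp (-(Complex.I * ((inner ℝ y (a • v) : ℝ) : ℂ))) *
        ((Real.exp (-(t * spectralIntegral α μ (a • v))) : ℝ) : ℂ) := by
    rw [unitKernel, Real.fourier_eq']
    congr 1
    ext1 v
    rw [spectralIntegral_smul μ ha0.le, ← mul_assoc, hat, one_mul, smul_eq_mul]
    congr 2
    have : -2 * Real.pi * inner ℝ v (kernelScale α t • y) = -inner ℝ y (a • v) := by
      rw [kernelScale, ← ha, inner_smul_right, inner_smul_right, real_inner_comm]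
      field_simp
    rw [this]
    push_cast
    ring
  rw [← hK, finrank_euclideanSpace_fin, abs_of_nonneg (by positivity)] at h
  rw [heatKernel, h, Complex.smul_re, smul_eq_mul, kernelScale, ← ha, mul_pow _ a, inv_pow]
  have : a ^ d ≠ 0 := by positivity
  field_simp

section Regularity

variable {c : ℝ} {μ : Measure (UnitSphere d)}

lemma integrable_norm_pow_mul_exp_neg_spectralIntegral [Nontrivial (EuclideanSpace ℝ (Fin d))]
    (hα : 0 < α) (hc : 0 < c) (hμ : ∀ ξ, c * ‖ξ‖ ^ α ≤ spectralIntegral α μ ξ)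
    (hcont : Continuous (fun ξ => ((Real.exp (-spectralIntegral α μ ξ) : ℝ) : ℂ))) (n : ℕ) :
    Integrable (fun ξ : EuclideanSpace ℝ (Fin d) =>
      ‖ξ‖ ^ n * ‖((Real.exp (-spectralIntegral α μ ξ) : ℝ) : ℂ)‖) := by
  refine integrable_norm_pow_mul_of_le_exp (B := 1) hc hα hcont.aestronglyMeasurable
    (fun v => ?_) n
  rw [Complex.norm_real, Real.norm_of_nonneg (Real.exp_pos _).le, one_mul]
  exact Real.exp_le_exp.2 (neg_le_neg (hμ v))

lemma contDiff_unitKernel [Nontrivial (EuclideanSpace ℝ (Fin d))]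
    (hα : 0 < α) (hc : 0 < c) (hμ : ∀ ξ, c * ‖ξ‖ ^ α ≤ spectralIntegral α μ ξ)
    (hcont : Continuous (fun ξ => ((Real.exp (-spectralIntegral α μ ξ) : ℝ) : ℂ))) :
    ContDiff ℝ ∞ (unitKernel α μ) :=
  Real.contDiff_fourier (N := ⊤) fun n _ =>
    integrable_norm_pow_mul_exp_neg_spectralIntegral hα hc hμ hcont n

/-- The transformed function is real and even, so its transform is real. -/
lemma ofReal_re_unitKernel (μ : Measure (UnitSphere d)) (y : EuclideanSpace ℝ (Fin d)) :
    ((unitKernel α μ y).re : ℂ) = unitKernel α μ y := by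
  refine Complex.conj_eq_iff_re.1 ?_
  rw [unitKernel, Real.fourier_eq', ← integral_conj, ← integral_neg_eq_self]
  congr 1
  ext1 v
  rw [smul_eq_mul, map_mul, ← Complex.exp_conj, map_mul, Complex.conj_I, Complex.conj_ofReal,
    Complex.conj_ofReal, spectralIntegral_neg, smul_eq_mul]
  simp

lemma contDiff_heatKernel (hα : 0 < α) (hK : ContDiff ℝ ∞ (unitKernel α μ)) {t : ℝ} (ht : 0 < t) :
    ContDiff ℝ ∞ (heatKernel α μ t) := by
  rw [show heatKernel α μ t = _ from funext fun y => heatKernel_eq hα μ ht y]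
  exact contDiff_const.mul (Complex.reCLM.contDiff.comp (hK.comp (contDiff_const_smul _)))

lemma norm_iteratedFDeriv_heatKernel_le (hα : 0 < α) (hK : ContDiff ℝ ∞ (unitKernel α μ)) {t : ℝ}
    (ht : 0 < t) (k : ℕ) (y : EuclideanSpace ℝ (Fin d)) :
    ‖iteratedFDeriv ℝ k (heatKernel α μ t) y‖ ≤ kernelScale α t ^ d *
      (kernelScale α t ^ k * ‖iteratedFDeriv ℝ k (unitKernel α μ) (kernelScale α t • y)‖) := by
  have hb := kernelScale_pos (α := α) ht
  set b := kernelScale α t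
  have hk : ((k : ℕ∞) : ℕ∞ω) ≤ ∞ := by exact_mod_cast le_top
  have hre : ContDiff ℝ ∞ (Complex.reCLM ∘ unitKernel α μ) := Complex.reCLM.contDiff.comp hK
  have h1 : heatKernel α μ t = fun y => b ^ d • (Complex.reCLM ∘ unitKernel α μ) (b • y) :=
    funext fun y => heatKernel_eq hα μ ht y
  have h2 : ContDiff ℝ k fun y => (Complex.reCLM ∘ unitKernel α μ) (b • y) :=
    (hre.comp (contDiff_const_smul b)).of_le hk
  rw [h1, iteratedFDeriv_const_smul_apply' h2.contDiffAt, norm_smul,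
    Real.norm_of_nonneg (by positivity), iteratedFDeriv_comp_const_smul b (hre.of_le hk)]
  gcongr
  rw [norm_smul, Real.norm_of_nonneg (by positivity)]
  gcongr
  refine (Complex.reCLM.norm_iteratedFDeriv_comp_left hK.contDiffAt hk).trans ?_
  rw [Complex.reCLM_norm, one_mul]

/-- The exact constant is `(2π)^(γ-k)`; as `γ - k ≤ 1` and `2π ≥ 1`, it is at most `2π` for every
`k`, including `k = 0`. -/
lemma kernelScale_rpow_le {t γ : ℝ} (ht : 0 < t) (hγ1 : γ ≤ 1) (k : ℕ) :
    kernelScale α t ^ ((k : ℝ) - γ) ≤ 2 * Real.pi / t ^ (((k : ℝ) - γ) / α) := by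
  have h2 : (0 : ℝ) < 2 * Real.pi := by positivity
  rw [kernelScale, Real.mul_rpow (by positivity) (Real.rpow_nonneg ht.le _),
    ← Real.rpow_mul ht.le, Real.inv_rpow h2.le, ← Real.rpow_neg h2.le, div_eq_mul_inv,
    ← Real.rpow_neg ht.le]
  have h3 : -α⁻¹ * ((k : ℝ) - γ) = -(((k : ℝ) - γ) / α) := by ring
  rw [h3]
  gcongr
  calc (2 * Real.pi) ^ (-((k : ℝ) - γ)) ≤ (2 * Real.pi) ^ (1 : ℝ) := by
        refine Real.rpow_le_rpow_of_exponent_le (by linarith [Real.pi_gt_three]) ?_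
        linarith [(Nat.cast_nonneg k : (0 : ℝ) ≤ k)]
    _ = 2 * Real.pi := Real.rpow_one _

/-- Under `z = b y` the derivatives give `b^k`, the weight gives `b^(-γ)`, and the prefactor `b^d`
cancels the Jacobian. -/
lemma weightedDerivBound_heatKernel (hα : 0 < α) (hK : ContDiff ℝ ∞ (unitKernel α μ)) {γ C : ℝ}
    (hγ1 : γ ≤ 1) (hC : 0 ≤ C) {k : ℕ}
    (hw : ∫⁻ y, ENNReal.ofReal (‖y‖ ^ γ * ‖iteratedFDeriv ℝ k (unitKernel α μ) y‖) ≤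
      ENNReal.ofReal C) {t : ℝ} (ht : 0 < t) :
    WeightedDerivBound γ k (heatKernel α μ t)
      (2 * Real.pi * C / t ^ (((k : ℝ) - γ) / α)) := by
  have hb := kernelScale_pos (α := α) ht
  have hscale := kernelScale_rpow_le (α := α) ht hγ1 k
  set b := kernelScale α t
  have hk : ((k : ℕ∞) : ℕ∞ω) ≤ ∞ := by exact_mod_cast le_top
  set W : EuclideanSpace ℝ (Fin d) → ℝ :=
    fun y => ‖y‖ ^ γ * ‖iteratedFDeriv ℝ k (unitKernel α μ) y‖ with hW
  have hpow : Measurable fun y : EuclideanSpace ℝ (Fin d) => ‖y‖ ^ γ := by fun_prop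
  have hW0 : ∀ y, 0 ≤ W y := fun y => by positivity
  have hWm : AEStronglyMeasurable W :=
    hpow.aestronglyMeasurable.mul (hK.continuous_iteratedFDeriv hk).norm.aestronglyMeasurable
  have hWi : Integrable W :=
    ⟨hWm, (hasFiniteIntegral_iff_ofReal (Filter.Eventually.of_forall hW0)).2
      (hw.trans_lt ENNReal.ofReal_lt_top)⟩
  have hWC : ∫ y, W y ≤ C := by
    rw [integral_eq_lintegral_of_nonneg_ae (Filter.Eventually.of_forall hW0) hWm]
    exact ENNReal.toReal_le_of_le_ofReal hC hw
  have hpt : ∀ y : EuclideanSpace ℝ (Fin d),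
      ‖y‖ ^ γ * ‖iteratedFDeriv ℝ k (heatKernel α μ t) y‖ ≤
        b ^ ((k : ℝ) - γ) * b ^ d * W (b • y) := by
    intro y
    calc ‖y‖ ^ γ * ‖iteratedFDeriv ℝ k (heatKernel α μ t) y‖
        ≤ ‖y‖ ^ γ * (b ^ d *
          (b ^ k * ‖iteratedFDeriv ℝ k (unitKernel α μ) (b • y)‖)) := by
          gcongr
          exact norm_iteratedFDeriv_heatKernel_le hα hK ht k y
      _ = b ^ ((k : ℝ) - γ) * b ^ d * W (b • y) := by
          rw [hW]
          simp only
          rw [norm_smul, Real.norm_of_nonneg hb.le, Real.mul_rpow hb.le (norm_nonneg _),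
            Real.rpow_sub hb, Real.rpow_natCast]
          have : b ^ γ ≠ 0 := (Real.rpow_pos_of_pos hb _).ne'
          field_simp
  have hdom : Integrable fun y => b ^ ((k : ℝ) - γ) * b ^ d * W (b • y) :=
    (hWi.comp_smul hb.ne').const_mul _
  refine ⟨hdom.mono' ?_ (Filter.Eventually.of_forall fun y => ?_), ?_⟩
  · exact hpow.aestronglyMeasurable.mul
      ((contDiff_heatKernel hα hK ht).continuous_iteratedFDeriv hk).norm.aestronglyMeasurable
  · rw [Real.norm_of_nonneg (by positivity)]
    exact hpt y
  · calc ∫ y, ‖y‖ ^ γ * ‖iteratedFDeriv ℝ k (heatKernel α μ t) y‖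
        ≤ ∫ y, b ^ ((k : ℝ) - γ) * b ^ d * W (b • y) :=
          integral_mono_of_nonneg (Filter.Eventually.of_forall fun y => by positivity) hdom
            (Filter.Eventually.of_forall hpt)
      _ = b ^ ((k : ℝ) - γ) * ∫ y, W y := by
          rw [integral_const_mul, Measure.integral_comp_smul, finrank_euclideanSpace_fin,
            abs_of_nonneg (by positivity), smul_eq_mul]
          have : b ^ d ≠ 0 := by positivity
          field_simp
      _ ≤ 2 * Real.pi / t ^ (((k : ℝ) - γ) / α) * C := by
          have : 0 < t ^ (((k : ℝ) - γ) / α) := Real.rpow_pos_of_pos ht _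
          gcongr
      _ = _ := by ring

/-- After rescaling, the characteristic function is the inverse transform of `unitKernel` at `ξ /
(2π b)`, where inversion and homogeneity apply. -/
lemma charFun_withDensity_heatKernel (hα : 0 < α)
    (hf : Integrable (fun ξ => ((Real.exp (-spectralIntegral α μ ξ) : ℝ) : ℂ)))
    (hcont : Continuous (fun ξ => ((Real.exp (-spectralIntegral α μ ξ) : ℝ) : ℂ)))
    (hK : Integrable (unitKernel α μ)) (hKc : Continuous (unitKernel α μ))
    (hK0 : ∀ y, 0 ≤ (unitKernel α μ y).re) {t : ℝ} (ht : 0 < t) (ξ : EuclideanSpace ℝ (Fin d)) :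
    charFun (volume.withDensity (fun y => ENNReal.ofReal (heatKernel α μ t y))) ξ =
      ((Real.exp (-(t * spectralIntegral α μ ξ)) : ℝ) : ℂ) := by
  have hb := kernelScale_pos (α := α) ht
  have hbd : kernelScale α t = (2 * Real.pi)⁻¹ * t ^ (-α⁻¹) := rfl
  have hheat := fun y => heatKernel_eq hα μ ht y
  set b := kernelScale α t
  have hm : Measurable fun y => ENNReal.ofReal (heatKernel α μ t y) := by
    simp_rw [hheat]
    have : Continuous fun y => b ^ d * (unitKernel α μ (b • y)).re :=
      continuous_const.mul (Complex.continuous_re.comp (hKc.comp (continuous_const_smul b)))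
    exact this.measurable.ennreal_ofReal
  rw [charFun_apply, integral_withDensity_eq_integral_toReal_smul hm (by simp)]
  have h1 : ∀ y : EuclideanSpace ℝ (Fin d), (ENNReal.ofReal (heatKernel α μ t y)).toReal •
      Complex.exp ((inner ℝ y ξ : ℝ) * Complex.I) =
      ((b ^ d : ℝ) : ℂ) * (Complex.exp (((2 * Real.pi * inner ℝ (b • y)
        ((2 * Real.pi * b)⁻¹ • ξ) : ℝ) : ℂ) * Complex.I) • unitKernel α μ (b • y)) := by
    intro y
    rw [ENNReal.toReal_ofReal (by rw [hheat]; exact mul_nonneg (by positivity) (hK0 _)), hheat,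
      ← ofReal_re_unitKernel μ (b • y), Complex.real_smul, smul_eq_mul, Complex.ofReal_re]
    have : 2 * Real.pi * inner ℝ (b • y) ((2 * Real.pi * b)⁻¹ • ξ) = inner ℝ y ξ := by
      rw [real_inner_smul_left, real_inner_smul_right]
      field_simp
    rw [this]
    push_cast
    ring
  simp_rw [h1]
  rw [integral_const_mul, Measure.integral_comp_smul
    (volume : Measure (EuclideanSpace ℝ (Fin d))) (fun z => Complex.exp (((2 * Real.pi * inner ℝ z
        ((2 * Real.pi * b)⁻¹ • ξ) : ℝ) : ℂ) * Complex.I) • unitKernel α μ z),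
    finrank_euclideanSpace_fin, abs_of_nonneg (by positivity), ← Real.fourierInv_eq', unitKernel,
    hcont.fourierInv_fourier_eq hf hK, Complex.real_smul, ← mul_assoc, ← Complex.ofReal_mul,
    mul_inv_cancel₀ (by positivity), Complex.ofReal_one, one_mul]
  beta_reduce
  rw [spectralIntegral_smul μ (by positivity)]
  congr 4
  rw [hbd, ← mul_assoc, mul_inv_cancel₀ (by positivity), one_mul, Real.rpow_neg ht.le, inv_inv,
    ← Real.rpow_mul ht.le, inv_mul_cancel₀ hα.ne', Real.rpow_one]

end Regularity

end HeatKernel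

/-! ### Consequences of non-degeneracy, uniform in the spherical measure. -/

section NonDegenerate

variable {d : ℕ} {α η : ℝ} {m : Measure (UnitSphere d)} [IsFiniteMeasure m]

lemma exp_levyExponent_stableLevyMeasure (hα : α ∈ Ioo (0 : ℝ) 1) (hm : IsSymmetric m) :
    (fun ξ => Complex.exp (levyExponent (stableLevyMeasure α m) ξ)) =
      fun ξ => ((Real.exp (-spectralIntegral α (spectralMeasure α m) ξ) : ℝ) : ℂ) := by
  ext ξ
  rw [← levySymbol_eq_levyExponent, levySymbol_stableLevyMeasure hα m hm, Complex.ofReal_exp]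

lemma continuous_exp_neg_spectralIntegral (hα : α ∈ Ioo (0 : ℝ) 1) (hm : IsSymmetric m) :
    Continuous fun ξ => ((Real.exp (-spectralIntegral α (spectralMeasure α m) ξ) : ℝ) : ℂ) := by
  rw [← exp_levyExponent_stableLevyMeasure hα hm]
  exact continuous_exp_levyExponent (integrable_min_one_norm_stableLevyMeasure hα m)

lemma nontrivial_euclideanSpace (hd : 1 ≤ d) : Nontrivial (EuclideanSpace ℝ (Fin d)) := by
  have : Nonempty (Fin d) := ⟨⟨0, hd⟩⟩
  infer_instance

lemma integrable_exp_neg_spectralIntegral (hd : 1 ≤ d) (hα : α ∈ Ioo (0 : ℝ) 1) (hη : 0 < η)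
    (hm : IsSymmetric m) (h : NonDegenerate α η (spectralMeasure α m)) :
    Integrable fun ξ : EuclideanSpace ℝ (Fin d) =>
      ((Real.exp (-spectralIntegral α (spectralMeasure α m) ξ) : ℝ) : ℂ) := by
  have := nontrivial_euclideanSpace hd
  have hc := continuous_exp_neg_spectralIntegral hα hm
  have h0 := integrable_norm_pow_mul_exp_neg_spectralIntegral hα.1 (inv_pos.2 hη)
    (fun ξ => (h ξ).1) hc 0
  simp only [pow_zero, one_mul] at h0
  exact (integrable_norm_iff hc.aestronglyMeasurable).1 h0

lemma contDiff_unitKernel_of_nonDegenerate (hd : 1 ≤ d) (hα : α ∈ Ioo (0 : ℝ) 1) (hη : 0 < η)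
    (hm : IsSymmetric m) (h : NonDegenerate α η (spectralMeasure α m)) :
    ContDiff ℝ ∞ (unitKernel α (spectralMeasure α m)) := by
  have := nontrivial_euclideanSpace hd
  exact contDiff_unitKernel hα.1 (inv_pos.2 hη) (fun ξ => (h ξ).1)
    (continuous_exp_neg_spectralIntegral hα hm)

lemma exists_lintegral_unitKernel_le (hd : 1 ≤ d) (hα : α ∈ Ioo (0 : ℝ) 1) (hη : 0 < η) {γ : ℝ}
    (hγ0 : 0 ≤ γ) (hγ : γ < α) (K : ℕ) :
    ∃ C : ℝ, 0 < C ∧ ∀ (m : Measure (UnitSphere d)) [IsFiniteMeasure m], IsSymmetric m →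
      NonDegenerate α η (spectralMeasure α m) → ∀ k ≤ K,
      ∫⁻ y, ENNReal.ofReal
        (‖y‖ ^ γ * ‖iteratedFDeriv ℝ k (unitKernel α (spectralMeasure α m)) y‖) ≤
          ENNReal.ofReal C := by
  have := nontrivial_euclideanSpace hd
  have hC := spectralConst_pos hα
  have h1 : 0 < 1 - α := by linarith [hα.2]
  have h2 : 0 < α - γ := by linarith
  have h3 := hα.1
  set T := d * η / spectralConst α
  have hT : 0 ≤ T := by positivity
  -- Per unit of spherical mass, the three summands are the first moment of the small jumps, the
  -- mass of the large jumps and their `γ`-moment; `T` bounds the spherical mass.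
  obtain ⟨C, hC0, hC⟩ := exists_weighted_bound_levy (V := EuclideanSpace ℝ (Fin d))
    (inv_pos.2 hη) hα.1 K hγ0 (hγ.le.trans hα.2.le)
    (T * (1 / (1 - α) + 1 / α + 1 / (α - γ)))
  refine ⟨C, hC0, fun m _ hm h k hk => ?_⟩
  have hmT : m.real univ ≤ T := measureReal_univ_le_of_nonDegenerate hα m h
  have key := hC (stableLevyMeasure α m) (integrable_min_one_norm_stableLevyMeasure hα m)
    ?_ ?_ ?_ ?_ k hk
  · rwa [exp_levyExponent_stableLevyMeasure hα hm] at key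
  · rw [setIntegral_closedBall_stableLevyMeasure hα]
    gcongr
    have : 0 < 1 / α + 1 / (α - γ) := by positivity
    linarith
  · rw [measureReal_compl_closedBall_stableLevyMeasure hα.1]
    gcongr
    have : 0 < 1 / (1 - α) := by positivity
    have : 0 < 1 / (α - γ) := by positivity
    linarith
  · rw [setLIntegral_compl_closedBall_stableLevyMeasure hγ, ← ofReal_measureReal (μ := m),
      ← ENNReal.ofReal_mul measureReal_nonneg]
    apply ENNReal.ofReal_le_ofReal
    gcongr
    have : 0 < 1 / (1 - α) + 1 / α := by positivity
    linarith
  · intro ξ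
    rw [← levySymbol_eq_levyExponent, levySymbol_stableLevyMeasure hα m hm, Complex.ofReal_re]
    exact neg_le_neg (h ξ).1

lemma exists_weightedDerivBound_heatKernel (hd : 1 ≤ d) (hα : α ∈ Ioo (0 : ℝ) 1) (hη : 0 < η)
    {γ : ℝ} (hγ0 : 0 ≤ γ) (hγ : γ < α) (K : ℕ) :
    ∃ C : ℝ, 0 < C ∧ ∀ (m : Measure (UnitSphere d)) [IsFiniteMeasure m], IsSymmetric m →
      NonDegenerate α η (spectralMeasure α m) → ∀ k ≤ K, ∀ t : ℝ, 0 < t →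
        WeightedDerivBound γ k (heatKernel α (spectralMeasure α m) t)
          (C / t ^ (((k : ℝ) - γ) / α)) := by
  obtain ⟨C, hC0, hC⟩ := exists_lintegral_unitKernel_le hd hα hη hγ0 hγ K
  refine ⟨2 * Real.pi * C, by positivity, fun m _ hm h k hk t ht => ?_⟩
  exact weightedDerivBound_heatKernel hα.1 (contDiff_unitKernel_of_nonDegenerate hd hα hη hm h)
    (hγ.le.trans hα.2.le) hC0.le (hC m hm h k hk) ht

lemma unitKernel_re_nonneg (hd : 1 ≤ d) (hα : α ∈ Ioo (0 : ℝ) 1) (hη : 0 < η)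
    (hm : IsSymmetric m) (h : NonDegenerate α η (spectralMeasure α m))
    (y : EuclideanSpace ℝ (Fin d)) : 0 ≤ (unitKernel α (spectralMeasure α m) y).re := by
  have hi := integrable_exp_neg_spectralIntegral hd hα hη hm h
  rw [← exp_levyExponent_stableLevyMeasure hα hm] at hi
  have := fourier_exp_levyExponent_re_nonneg (integrable_min_one_norm_stableLevyMeasure hα m) hi y
  rwa [exp_levyExponent_stableLevyMeasure hα hm] at this

lemma heatKernel_nonneg (hd : 1 ≤ d) (hα : α ∈ Ioo (0 : ℝ) 1) (hη : 0 < η)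
    (hm : IsSymmetric m) (h : NonDegenerate α η (spectralMeasure α m)) {t : ℝ} (ht : 0 < t)
    (y : EuclideanSpace ℝ (Fin d)) : 0 ≤ heatKernel α (spectralMeasure α m) t y := by
  rw [heatKernel_eq hα.1 _ ht]
  exact mul_nonneg (pow_nonneg (kernelScale_pos ht).le _) (unitKernel_re_nonneg hd hα hη hm h _)

/-- The weighted bound with `γ = 0` and no derivative, as needed for Fourier inversion. -/
lemma integrable_unitKernel (hd : 1 ≤ d) (hα : α ∈ Ioo (0 : ℝ) 1) (hη : 0 < η)
    (hm : IsSymmetric m) (h : NonDegenerate α η (spectralMeasure α m)) :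
    Integrable (unitKernel α (spectralMeasure α m)) := by
  obtain ⟨C, -, hC⟩ := exists_lintegral_unitKernel_le hd hα hη le_rfl hα.1 0
  have h0 := hC m hm h 0 le_rfl
  simp only [Real.rpow_zero, one_mul, norm_iteratedFDeriv_zero] at h0
  exact ⟨(contDiff_unitKernel_of_nonDegenerate hd hα hη hm h).continuous.aestronglyMeasurable,
    (hasFiniteIntegral_iff_norm _).2 (h0.trans_lt ENNReal.ofReal_lt_top)⟩

lemma isSemigroupDensity_heatKernel (hd : 1 ≤ d) (hα : α ∈ Ioo (0 : ℝ) 1) (hη : 0 < η)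
    (hm : IsSymmetric m) (h : NonDegenerate α η (spectralMeasure α m)) :
    IsSemigroupDensity (stableLevyMeasure α m) (heatKernel α (spectralMeasure α m)) := by
  intro t ht
  have hchar := charFun_withDensity_heatKernel hα.1
    (integrable_exp_neg_spectralIntegral hd hα hη hm h)
    (continuous_exp_neg_spectralIntegral hα hm) (integrable_unitKernel hd hα hη hm h)
    (contDiff_unitKernel_of_nonDegenerate hd hα hη hm h).continuous
    (unitKernel_re_nonneg hd hα hη hm h) ht
  refine ⟨heatKernel_nonneg hd hα hη hm h ht, ⟨?_⟩, fun ξ => ?_⟩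
  -- The total mass is read off from the characteristic function at the origin.
  · have h0 := hchar 0
    have hz : spectralIntegral α (spectralMeasure α m) 0 = 0 := by
      simp [spectralIntegral, Real.zero_rpow hα.1.ne']
    rw [charFun_zero, hz, mul_zero, neg_zero, Real.exp_zero, Complex.ofReal_inj] at h0
    exact (ENNReal.toReal_eq_one_iff _).1 h0
  · rw [hchar, levySymbol_stableLevyMeasure hα m hm, Complex.ofReal_exp]
    push_cast
    ring_nf

lemma momentAssumption_heatKernel (hd : 1 ≤ d) (hα : α ∈ Ioo (0 : ℝ) 1) (hη : 0 < η)
    (hm : IsSymmetric m) (h : NonDegenerate α η (spectralMeasure α m)) :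
    MomentAssumption α (stableLevyMeasure α m) (heatKernel α (spectralMeasure α m)) := by
  refine ⟨isSemigroupDensity_heatKernel hd hα hη hm h, fun t ht => ?_, fun γ hγ0 hγ => ?_⟩
  · exact_mod_cast contDiff_infty.1 (contDiff_heatKernel hα.1
      (contDiff_unitKernel_of_nonDegenerate hd hα hη hm h) ht) 2
  -- A moment of a nonnegative kernel is the weighted bound of derivative order `0`, whose time
  -- factor `1 / t^(-γ/α)` is `t^(γ/α)`.
  · obtain ⟨C, hC0, hC⟩ := exists_weightedDerivBound_heatKernel hd hα hη hγ0.le hγ 0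
    refine ⟨C, hC0, fun t ht => ?_⟩
    have hb := hC m hm h 0 le_rfl t ht.1
    have hn : ∀ y, ‖heatKernel α (spectralMeasure α m) t y‖ =
        heatKernel α (spectralMeasure α m) t y := fun y =>
      Real.norm_of_nonneg (heatKernel_nonneg hd hα hη hm h ht.1 y)
    simp only [WeightedDerivBound, norm_iteratedFDeriv_zero, hn, CharP.cast_eq_zero, zero_sub,
      neg_div, Real.rpow_neg ht.1.le, div_inv_eq_mul] at hb
    exact hb

lemma propertyP_heatKernel (hd : 1 ≤ d) (hα : α ∈ Ioo (0 : ℝ) 1) (hη : 0 < η)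
    (hm : IsSymmetric m) (h : NonDegenerate α η (spectralMeasure α m)) {β : ℝ} (hβ0 : 0 < β)
    (hβ : β < α) : PropertyP α β (heatKernel α (spectralMeasure α m)) := by
  obtain ⟨C, hC0, hC⟩ := exists_weightedDerivBound_heatKernel hd hα hη hβ0.le hβ 2
  refine ⟨C, hC0, fun t ht k hk => hC m hm h k ?_ t ht.1⟩
  rcases hk with rfl | rfl <;> norm_num

end NonDegenerate

/-! ### The cylindrical example. -/

section Cylindrical

variable {d : ℕ} {α : ℝ}

instance isFiniteMeasure_cylindricalSphericalMeasure :
    IsFiniteMeasure (cylindricalSphericalMeasure d α) := by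
  unfold cylindricalSphericalMeasure
  refine ⟨?_⟩
  simp only [Measure.smul_apply, Measure.finsetSum_apply, Measure.add_apply, measure_univ,
    smul_eq_mul]
  refine ENNReal.mul_lt_top ENNReal.ofReal_lt_top ?_
  simp

lemma isSymmetric_cylindricalSphericalMeasure :
    IsSymmetric (cylindricalSphericalMeasure d α) := by
  have hmeas : Measurable fun s : UnitSphere d => -s := continuous_neg.measurable
  ext A hA
  rw [Measure.map_apply hmeas hA]
  simp only [cylindricalSphericalMeasure, Measure.smul_apply, Measure.finsetSum_apply,
    Measure.add_apply, Measure.dirac_apply' _ hA, Measure.dirac_apply' _ (hmeas hA)]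
  congr 1
  refine Finset.sum_congr rfl fun k _ => ?_
  have h : ∀ s : UnitSphere d, ((fun s => -s) ⁻¹' A).indicator (1 : UnitSphere d → ENNReal) s =
      A.indicator 1 (-s) := fun s => rfl
  rw [add_comm, h, h, neg_neg]

lemma spectralIntegral_cylindricalSphericalMeasure (hα : α ∈ Ioo (0 : ℝ) 1)
    (ξ : EuclideanSpace ℝ (Fin d)) :
    spectralIntegral α (spectralMeasure α (cylindricalSphericalMeasure d α)) ξ =
      ∑ k, |ξ k| ^ α := by
  have hC := spectralConst_pos hα
  have hi : ∀ s : UnitSphere d, Integrable (fun s : UnitSphere d =>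
      |(inner ℝ ξ (s : EuclideanSpace ℝ (Fin d)) : ℝ)| ^ α) (Measure.dirac s) := fun s =>
    integrable_abs_inner_rpow hα.1 _ ξ
  rw [spectralIntegral_spectralMeasure hα, cylindricalSphericalMeasure, integral_smul_measure,
    integral_finsetSum_measure fun k _ => (hi _).add_measure (hi _)]
  have h : ∀ k : Fin d, ∫ s : UnitSphere d, |(inner ℝ ξ (s : EuclideanSpace ℝ (Fin d)) : ℝ)| ^ α
      ∂(Measure.dirac (canonicalDirection k) + Measure.dirac (-canonicalDirection k)) =
      2 * |ξ k| ^ α := by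
    intro k
    rw [integral_add_measure (hi _) (hi _), integral_dirac, integral_dirac]
    simp [canonicalDirection, EuclideanSpace.inner_single_right, two_mul]
  simp_rw [h]
  rw [← Finset.mul_sum, ENNReal.toReal_ofReal (by positivity), smul_eq_mul]
  field_simp

/-- The upper bound uses `|ξ k| ≤ ‖ξ‖` for each of the `d` coordinates, whence the constant `d`; the
lower bound holds even with constant `1`. -/
lemma nonDegenerate_cylindricalSphericalMeasure (hα : α ∈ Ioo (0 : ℝ) 1) (hd : 1 ≤ d) :
    NonDegenerate α d (spectralMeasure α (cylindricalSphericalMeasure d α)) := by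
  intro ξ
  have h1 : (1 : ℝ) ≤ d := by exact_mod_cast hd
  rw [spectralIntegral_cylindricalSphericalMeasure hα]
  constructor
  · exact (mul_le_of_le_one_left (by positivity) (inv_le_one_of_one_le₀ h1)).trans
      (norm_rpow_le_sum_abs_rpow hα ξ)
  · calc ∑ k, |ξ k| ^ α ≤ ∑ _k : Fin d, ‖ξ‖ ^ α := by
          gcongr with k _
          · exact hα.1.le
          · simpa using PiLp.norm_apply_le ξ k
      _ = d * ‖ξ‖ ^ α := by simp

end Cylindrical

end StableKernel

end

/-! ### The main theorem. -/

theorem proposition1 (d : ℕ) (hd : 1 ≤ d) (α : ℝ) (hα : α ∈ Set.Ioo (0 : ℝ) 1) :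
    -- the estimate, with a constant that depends only on `d`, `α`, `η` and `γ`
    (∀ η : ℝ, 1 ≤ η → ∀ γ : ℝ, 0 ≤ γ → γ < α → ∃ C : ℝ, 0 < C ∧
      ∀ (m : MeasureTheory.Measure (StableKernel.UnitSphere d))
        [MeasureTheory.IsFiniteMeasure m],
        StableKernel.IsSymmetric m →
        StableKernel.NonDegenerate α η (StableKernel.spectralMeasure α m) →
        ∀ l ∈ ({1, 2} : Set ℕ), ∀ t : ℝ, 0 < t →
          StableKernel.WeightedDerivBound γ l
            (StableKernel.heatKernel α (StableKernel.spectralMeasure α m) t)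
            (C / t ^ (((l : ℝ) - γ) / α))) ∧
    -- the heat kernel is the smooth density of the stable semigroup, `(𝒫_β)` holds for
    -- `β < α`, and for `α > 1 / 2` the operator is admissible for some `β` with `α + β > 1`
    (∀ (m : MeasureTheory.Measure (StableKernel.UnitSphere d))
      [MeasureTheory.IsFiniteMeasure m],
      StableKernel.IsSymmetric m →
      (∃ η : ℝ, 1 ≤ η ∧
        StableKernel.NonDegenerate α η (StableKernel.spectralMeasure α m)) →
      StableKernel.IsFiniteVariationLevyMeasure (StableKernel.stableLevyMeasure α m) ∧
      StableKernel.MomentAssumption α (StableKernel.stableLevyMeasure α m)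
        (StableKernel.heatKernel α (StableKernel.spectralMeasure α m)) ∧
      (∀ t : ℝ, 0 < t →
        ContDiff ℝ ∞ (StableKernel.heatKernel α (StableKernel.spectralMeasure α m) t)) ∧
      (∀ β : ℝ, 0 < β → β < α →
        StableKernel.PropertyP α β
          (StableKernel.heatKernel α (StableKernel.spectralMeasure α m))) ∧
      (1 / 2 < α → ∃ β ∈ Set.Ioo (0 : ℝ) 1, 1 < α + β ∧
        StableKernel.PropertyP α β
          (StableKernel.heatKernel α (StableKernel.spectralMeasure α m)))) ∧
    -- the cylindrical operator is covered
    (MeasureTheory.IsFiniteMeasure (StableKernel.cylindricalSphericalMeasure d α) ∧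
      StableKernel.IsSymmetric (StableKernel.cylindricalSphericalMeasure d α) ∧
      (∃ η : ℝ, 1 ≤ η ∧ StableKernel.NonDegenerate α η
        (StableKernel.spectralMeasure α (StableKernel.cylindricalSphericalMeasure d α))) ∧
      ∀ ξ : EuclideanSpace ℝ (Fin d),
        StableKernel.levySymbol
          (StableKernel.stableLevyMeasure α (StableKernel.cylindricalSphericalMeasure d α)) ξ =
          ((-∑ k : Fin d, |ξ k| ^ α : ℝ) : ℂ)) := by
  refine ⟨fun η hη γ hγ0 hγ => ?_, fun m _ hm hnd => ?_, ?_, ?_, ?_, ?_⟩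
  · obtain ⟨C, hC0, hC⟩ := StableKernel.exists_weightedDerivBound_heatKernel hd hα
      (zero_lt_one.trans_le hη) hγ0 hγ 2
    refine ⟨C, hC0, fun m _ hm h l hl t ht => hC m hm h l ?_ t ht⟩
    rcases hl with rfl | rfl <;> norm_num
  · obtain ⟨η, hη1, h⟩ := hnd
    have hη := zero_lt_one.trans_le hη1
    refine ⟨StableKernel.isFiniteVariationLevyMeasure_stableLevyMeasure hα m,
      StableKernel.momentAssumption_heatKernel hd hα hη hm h,
      fun t ht => StableKernel.contDiff_heatKernel hα.1
        (StableKernel.contDiff_unitKernel_of_nonDegenerate hd hα hη hm h) ht,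
      fun β hβ0 hβ => StableKernel.propertyP_heatKernel hd hα hη hm h hβ0 hβ, fun hα2 => ?_⟩
    -- The interval `(1 - α, α)` is nonempty exactly when `α > 1 / 2`.
    obtain ⟨β, hβ1, hβ2⟩ := exists_between (show 1 - α < α by linarith)
    have hβ0 : 0 < β := by linarith [hα.2]
    exact ⟨β, ⟨hβ0, hβ2.trans hα.2⟩, by linarith,
      StableKernel.propertyP_heatKernel hd hα hη hm h hβ0 hβ2⟩
  · exact StableKernel.isFiniteMeasure_cylindricalSphericalMeasure
  · exact StableKernel.isSymmetric_cylindricalSphericalMeasure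
  · exact ⟨d, by exact_mod_cast hd, StableKernel.nonDegenerate_cylindricalSphericalMeasure hα hd⟩
  · intro ξ
    rw [StableKernel.levySymbol_stableLevyMeasure hα _
      StableKernel.isSymmetric_cylindricalSphericalMeasure,
      StableKernel.spectralIntegral_cylindricalSphericalMeasure hα]
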